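/- **Setting.** For $n\ge 1$ consider convex finite-sum coupled compositional (cFCCO) problems $$\min_{x\in\mathcal X}F(x),\qquad F(x)=\frac1n\sum_{i=1}^n f_i(g_i(x))+r(x),\qquad g_i(x)=\mathbb E_{\zeta\sim\mathbb P_i}[g_i(x;\zeta)],$$ where $\mathcal X\subseteq\mathbb R^d$ is closed and convex with $0\in\mathcal X$; $r$ is lower semicontinuous and $\mu$-strongly convex on $\mathcal X$ (merely convex if $\mu=0$); $g_i:\mathbb R^d\to\mathbb R$ is convex, differentiable and $C_g$-Lipschitz, with $g_i(\cdot;\zeta)$ differentiable; $f_i:\mathbb R\to\mathbb R$ is convex and $C_f$-Lipschitz, and non-decreasing unless $g_i$ is affine; and, for all $x$ and all $y$ with $y_i\in\mathrm{dom} f_i^*$, $$\mathbb E|g_i(x)-g_i(x;\zeta)|^2\le\sigma_0^2,\quad \mathbb E\|\nabla g_i(x)-\nabla g_i(x;\zeta)\|^2\le\sigma_1^2,\quad \frac1n\sum_{j}\Big\|y_j\nabla g_j(x)-\frac1n\sum_i y_i\nabla g_i(x)\Big\|^2\le\delta^2 .$$ **Abstract scheme.** Fix $\tau,\eta>0$ and,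 for each $i$, a function $\psi_i$ that is strictly convex on its effective domain, with Bregman divergence $U_{\psi_i}$ formed with subgradients of $\psi_i$. The scheme maintains linear spaces $\mathfrak g_t^{(i)},\mathfrak Y_t^{(i)}\subseteq\mathbb R$ ($i\le n$) and $\mathfrak G_t,\mathfrak X_t\subseteq\mathbb R^d$, all equal to $\{0\}$ at $t=0$. In iteration $t$ it samples a batch $\mathcal S_t\subseteq\{1,\dots,n\}$ with $|\mathcal S_t|=S$ and $\zeta_t^{(i)},\tilde\zeta_t^{(i)}$ i.i.d. from $\mathbb P_i$, the batch being independent of $(\zeta_t^{(i)},\tilde\zeta_t^{(i)})$ for each $i$ (the joint law across blocks and across iterations is otherwise arbitrary). For $i\in\mathcal S_t$, $$\mathfrak g_{t+1}^{(i)}=\mathfrak g_t^{(i)}+\mathrm{span}\{g_i(\hat x;\zeta_t^{(i)}):\hat x\in\mathfrak X_t\},\qquad \mathfrak Y_{t+1}^{(i)}=\mathfrak Y_t^{(i)}+\mathrm{span}\{\mathrm{MP}_i(\hat y,\hat g):\hat y\in\mathfrak Y_t^{(i)},\hat g\in\mathfrak g_{t+1}^{(i)}\},$$ $\mathrm{MP}_i(\hat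 y,\hat g)=\arg\max_v\{v\hat g-f_i^*(v)-\tau U_{\psi_i}(v,\hat y)\}$; for $i\notin\mathcal S_t$ these two spaces do not change. Then $$\mathfrak G_{t+1}=\mathfrak G_t+\mathrm{span}\Big\{\frac1S\sum_{i\in\mathcal S_t}\hat y^{(i)}\nabla g_i(\hat x;\tilde\zeta_t^{(i)}):\hat x\in\mathfrak X_t,\ \hat y^{(i)}\in\mathfrak Y_{t+1}^{(i)}\Big\},$$ $$\mathfrak X_{t+1}=\mathfrak X_t+\mathrm{span}\Big\{\arg\min_{x\in\mathcal X}\{x^\top\hat G+r(x)+\tfrac\eta2\|x-\hat x\|^2\}:\hat x\in\mathfrak X_t,\ \hat G\in\mathfrak G_{t+1}\Big\}.$$ After $T$ iterations ($ST$ oracle calls) an algorithm in the scheme outputs any random vector $\bar x$ with $\bar x\in\mathfrak X_T$ almost surely. **Theorem.** Let $C_f,C_g,\sigma_0,\delta>0$ and $\sigma_1\ge0$. There is a constant $c>0$, depending only on these, such that for all integers $1\le S\le n$ the following hold. 1. (*Smooth $f_i$, strongly convex problem.*) Let $\mu,L_f,\epsilon>0$ with $n\mu\le\max\{1,L_f^2\}$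 and $\epsilon(1+n\mu)\le c$. There are a $d$ and a problem of the above class on $\mathbb R^d$, with strong convexity modulus $\mu$, all $f_i$ $L_f$-smooth, and minimizer $x_*$, for which every algorithm in the abstract scheme (any $\tau,\eta,\psi_i$, any sampling as above, any $T$, any output) with $\frac\mu2\mathbb E\|\bar x-x_*\|^2\le\epsilon$ makes at least $c\max\{\frac S\mu,n\}\,\epsilon^{-1}$ oracle calls. Moreover, with only $\epsilon\mu\le c$ in place of the two restrictions on $n\mu$, there is such a problem requiring at least $c\,\frac S\mu\,\epsilon^{-1}$ oracle calls. 2. (*Non-smooth $f_i$, merely or strongly convex problem.*) Let $\mu\ge0$ and $\epsilon>0$ with $\epsilon(1+n\mu)\le c$. There are a $d$ and a problem of the above class on $\mathbb R^d$, with modulus $\mu$, no $f_i$ differentiable on all of $\mathbb R$, and a minimizer $x_*$, for which every algorithm in the abstract scheme whose output satisfies $\bar x\in\mathcal X$ almost surely and $\mathbb E[F(\bar x)-F(x_*)]\le\epsilon$ makes at least $c\,n\,\epsilon^{-2}$ oracle calls. -/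

import Mathlib

open MeasureTheory ProbabilityTheory

universe u

/-- The data of a finite-sum coupled compositional problem with `n` blocks on `ℝ^d`,
`min_{x ∈ X} F(x)`, `F(x) = (1/n) ∑ i, f i (E_{ζ ∼ P i} [g i x ζ]) + r x`,
with scalar inner functions. -/
structure CFCCO (n d : ℕ) where
  /-- the feasible set -/
  X : Set (EuclideanSpace ℝ (Fin d))
  /-- the regularizer -/
  r : EuclideanSpace ℝ (Fin d) → ℝ
  /-- the outer functions -/
  f : Fin n → ℝ → ℝ
  /-- the sample space of the stochastic oracles -/
  Z : Type
  mZ : MeasurableSpace Z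
  /-- the sampling distributions -/
  P : Fin n → @Measure Z mZ
  /-- the stochastic inner functions `g i x ζ` -/
  g : Fin n → EuclideanSpace ℝ (Fin d) → Z → ℝ

attribute [instance] CFCCO.mZ

/-- The effective domain of the convex conjugate of `f : ℝ → ℝ`. -/
def conjDom (f : ℝ → ℝ) : Set ℝ := {v | BddAbove (Set.range fun u : ℝ => v * u - f u)}

/-- The convex conjugate `f^*(v) = sup_u (v u - f u)`; only used for `v ∈ conjDom f`. -/
noncomputable def fenchelConj (f : ℝ → ℝ) (v : ℝ) : ℝ := ⨆ u : ℝ, (v * u - f u)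

/-- `f` is differentiable and `L`-smooth. -/
def OuterSmooth (f : ℝ → ℝ) (L : ℝ) : Prop :=
  Differentiable ℝ f ∧
    ∀ u v : ℝ, |f u - f v - deriv f v * (u - v)| ≤ L / 2 * (u - v) ^ 2

namespace CFCCO

variable {n d : ℕ}

/-- The inner function `g_i(x) = E_{ζ ∼ P i} [g i x ζ]`. -/
noncomputable def mean (p : CFCCO n d) (i : Fin n) (x : EuclideanSpace ℝ (Fin d)) : ℝ :=
  ∫ z, p.g i x z ∂(p.P i)

/-- The objective function `F`. -/
noncomputable def F (p : CFCCO n d) (x : EuclideanSpace ℝ (Fin d)) : ℝ :=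
  (1 / (n : ℝ)) * ∑ i, p.f i (p.mean i x) + p.r x

/-- `xs` minimizes `F` over the feasible set. -/
def IsMinimizer (p : CFCCO n d) (xs : EuclideanSpace ℝ (Fin d)) : Prop :=
  xs ∈ p.X ∧ IsMinOn p.F p.X xs

/-- `p` is a convex problem of the class with strong convexity modulus `μ` (`μ = 0`: merely
convex), Lipschitz constants `Cf`, `Cg` and variance bounds `σ0 ^ 2`, `σ1 ^ 2`, `δ ^ 2`.
The inner functions are defined, and the requirements on them are imposed, on all of `ℝ^d`. -/
structure InClass (p : CFCCO n d) (Cf Cg σ0 σ1 δ μ : ℝ) : Prop where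
  -- feasible set and regularizer
  X_closed : IsClosed p.X
  X_convex : Convex ℝ p.X
  X_zero : (0 : EuclideanSpace ℝ (Fin d)) ∈ p.X
  r_lsc : LowerSemicontinuousOn p.r p.X
  r_convex : StrongConvexOn p.X μ p.r
  -- stochastic inner functions
  prob : ∀ i, IsProbabilityMeasure (p.P i)
  g_integrable : ∀ i x, Integrable (p.g i x) (p.P i)
  g_diff : ∀ i z, Differentiable ℝ (fun x => p.g i x z)
  -- inner functions
  mean_diff : ∀ i, Differentiable ℝ (p.mean i)
  mean_convex : ∀ i, ConvexOn ℝ Set.univ (p.mean i)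
  mean_lip : ∀ i x x', |p.mean i x - p.mean i x'| ≤ Cg * ‖x - x'‖
  -- outer functions
  f_convex : ∀ i, ConvexOn ℝ Set.univ (p.f i)
  f_lip : ∀ i u u', |p.f i u - p.f i u'| ≤ Cf * |u - u'|
  f_mono : ∀ i, (∃ (a : EuclideanSpace ℝ (Fin d) →L[ℝ] ℝ) (b : ℝ), ∀ x, p.mean i x = a x + b) ∨
    Monotone (p.f i)
  -- variances of the zeroth-order and first-order oracles, and variability of the blocks
  var_zero : ∀ i x, ∫⁻ z, ENNReal.ofReal ((p.mean i x - p.g i x z) ^ 2) ∂(p.P i)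
    ≤ ENNReal.ofReal (σ0 ^ 2)
  var_one : ∀ i x, ∫⁻ z, ENNReal.ofReal
      (‖gradient (p.mean i) x - gradient (fun x' => p.g i x' z) x‖ ^ 2) ∂(p.P i)
    ≤ ENNReal.ofReal (σ1 ^ 2)
  var_block : ∀ (x : EuclideanSpace ℝ (Fin d)) (y : Fin n → ℝ), (∀ i, y i ∈ conjDom (p.f i)) →
    (1 / (n : ℝ)) * ∑ j, ‖y j • gradient (p.mean j) x
      - (1 / (n : ℝ)) • ∑ i, y i • gradient (p.mean i) x‖ ^ 2 ≤ δ ^ 2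

end CFCCO

/-- A distance-generating function: strictly convex on its effective domain `dom`
(a function that is finite on all of `ℝ` has `dom = univ`; `f^*` is allowed when it is
strictly convex on its effective domain). -/
structure DistGen where
  dom : Set ℝ
  fn : ℝ → ℝ
  strict : StrictConvexOn ℝ dom fn

namespace DistGen

/-- `q` is a subgradient of `ψ` at `v`. -/
def IsSubgrad (ψ : DistGen) (v q : ℝ) : Prop :=
  v ∈ ψ.dom ∧ ∀ w ∈ ψ.dom, ψ.fn v + q * (w - v) ≤ ψ.fn w

/-- The Bregman divergence `U_ψ(u, v)` formed with the subgradient `q` of `ψ` at `v`. -/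
def bregman (ψ : DistGen) (q u v : ℝ) : ℝ := ψ.fn u - ψ.fn v - q * (u - v)

end DistGen

/-- `v` is a value of the mirror-prox map
`MP(y, γ) = argmax_v {v γ - f^*(v) - τ U_ψ(v, y)}`. -/
def IsMP (f : ℝ → ℝ) (ψ : DistGen) (τ y γ v : ℝ) : Prop :=
  ∃ q : ℝ, ψ.IsSubgrad y q ∧ v ∈ conjDom f ∩ ψ.dom ∧
    IsMaxOn (fun w => w * γ - fenchelConj f w - τ * ψ.bregman q w y) (conjDom f ∩ ψ.dom) v

/-- `x` is a value of the proximal map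
`QP(x₀, G) = argmin_{x ∈ X} {⟨x, G⟩ + r(x) + (η/2) ‖x - x₀‖²}`. -/
def CFCCO.IsQP {n d : ℕ} (p : CFCCO n d) (η : ℝ) (x₀ G x : EuclideanSpace ℝ (Fin d)) : Prop :=
  x ∈ p.X ∧ IsMinOn (fun w => inner ℝ w G + p.r w + η / 2 * ‖w - x₀‖ ^ 2) p.X x

/-- The spaces maintained by the abstract scheme: the slices of the spaces of inner values and of
dual variables, the space of gradient estimators, and the primal space. -/
structure Spaces (n d : ℕ) where
  inn : Fin n → Submodule ℝ ℝ
  dual : Fin n → Submodule ℝ ℝ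
  grad : Submodule ℝ (EuclideanSpace ℝ (Fin d))
  primal : Submodule ℝ (EuclideanSpace ℝ (Fin d))

namespace Spaces

variable {n d : ℕ}

/-- All spaces are zero at the start. -/
def init (n d : ℕ) : Spaces n d := ⟨fun _ => ⊥, fun _ => ⊥, ⊥, ⊥⟩

open Classical in
/-- The slices of the space of inner values after an iteration with batch `B` and samples `z`. -/
noncomputable def nextInn (p : CFCCO n d) (B : Finset (Fin n)) (z : Fin n → p.Z)
    (s : Spaces n d) (i : Fin n) : Submodule ℝ ℝ :=
  if i ∈ B then s.inn i ⊔ Submodule.span ℝ {u | ∃ x ∈ s.primal, u = p.g i x (z i)}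
  else s.inn i

open Classical in
/-- The slices of the dual space after an iteration; `inn'` are the new slices of inner values. -/
noncomputable def nextDual (p : CFCCO n d) (τ : ℝ) (ψ : Fin n → DistGen) (B : Finset (Fin n))
    (inn' : Fin n → Submodule ℝ ℝ) (s : Spaces n d) (i : Fin n) : Submodule ℝ ℝ :=
  if i ∈ B then
    s.dual i ⊔ Submodule.span ℝ {v | ∃ y ∈ s.dual i, ∃ γ ∈ inn' i, IsMP (p.f i) (ψ i) τ y γ v}
  else s.dual i

/-- The gradient estimator `G(x, y) = (1/S) ∑_{i ∈ B} y_i ∇g_i(x; z'_i)`. -/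
noncomputable def gradEst (p : CFCCO n d) (B : Finset (Fin n)) (z' : Fin n → p.Z)
    (x : EuclideanSpace ℝ (Fin d)) (y : Fin n → ℝ) : EuclideanSpace ℝ (Fin d) :=
  (1 / (B.card : ℝ)) • ∑ i ∈ B, y i • gradient (fun x' => p.g i x' (z' i)) x

/-- The space of gradient estimators after an iteration; `dual'` are the new dual slices. -/
noncomputable def nextGrad (p : CFCCO n d) (B : Finset (Fin n)) (z' : Fin n → p.Z)
    (dual' : Fin n → Submodule ℝ ℝ) (s : Spaces n d) :
    Submodule ℝ (EuclideanSpace ℝ (Fin d)) :=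
  s.grad ⊔ Submodule.span ℝ
    {G | ∃ x ∈ s.primal, ∃ y : Fin n → ℝ, (∀ i, y i ∈ dual' i) ∧ G = gradEst p B z' x y}

/-- The primal space after an iteration; `grad'` is the new space of gradient estimators. -/
noncomputable def nextPrimal (p : CFCCO n d) (η : ℝ)
    (grad' : Submodule ℝ (EuclideanSpace ℝ (Fin d))) (s : Spaces n d) :
    Submodule ℝ (EuclideanSpace ℝ (Fin d)) :=
  s.primal ⊔ Submodule.span ℝ {x | ∃ x₀ ∈ s.primal, ∃ G ∈ grad', p.IsQP η x₀ G x}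

/-- One iteration of the abstract scheme with batch `B` and samples `z`, `z'`. -/
noncomputable def step (p : CFCCO n d) (τ η : ℝ) (ψ : Fin n → DistGen) (B : Finset (Fin n))
    (z z' : Fin n → p.Z) (s : Spaces n d) : Spaces n d :=
  let inn' := nextInn p B z s
  let dual' := nextDual p τ ψ B inn' s
  let grad' := nextGrad p B z' dual' s
  ⟨inn', dual', grad', nextPrimal p η grad' s⟩

/-- The spaces after `t` iterations, given the sequences of batches and of samples. -/
noncomputable def iter (p : CFCCO n d) (τ η : ℝ) (ψ : Fin n → DistGen)
    (B : ℕ → Finset (Fin n)) (z z' : ℕ → Fin n → p.Z) : ℕ → Spaces n d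
  | 0 => init n d
  | t + 1 => step p τ η ψ (B t) (z t) (z' t) (iter p τ η ψ B z z' t)

end Spaces

/-- The random batches and samples of the abstract scheme. In every iteration `t` the batch has
`S` elements, `ζ t i` and `ζ' t i` are i.i.d. with law `P i`, and the batch is independent of
them. Nothing else is required of the joint law across blocks and iterations, nor that batches be
uniform: sampling everything independently is a special case, and so is sharing a sample between
the blocks. -/
structure Sampling {n d : ℕ} (p : CFCCO n d) (S : ℕ) {Ω : Type u} [MeasurableSpace Ω]
    (Pr : Measure Ω) where
  batch : ℕ → Ω → Finset (Fin n)
  ζ : ℕ → Fin n → Ω → p.Z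
  ζ' : ℕ → Fin n → Ω → p.Z
  batch_meas : ∀ t, Measurable (batch t)
  ζ_meas : ∀ t i, Measurable (ζ t i)
  ζ'_meas : ∀ t i, Measurable (ζ' t i)
  batch_card : ∀ t ω, (batch t ω).card = S
  ζ_law : ∀ t i, Pr.map (ζ t i) = p.P i
  ζ'_law : ∀ t i, Pr.map (ζ' t i) = p.P i
  ζ_indep : ∀ t i, IndepFun (ζ t i) (ζ' t i) Pr
  batch_indep : ∀ t i, IndepFun (batch t) (fun ω => (ζ t i ω, ζ' t i ω)) Pr

/-- The random primal space after `T` iterations of the abstract scheme. -/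
noncomputable def Sampling.primal {n d : ℕ} {p : CFCCO n d} {S : ℕ} {Ω : Type u}
    [MeasurableSpace Ω] {Pr : Measure Ω} (s : Sampling p S Pr) (τ η : ℝ) (ψ : Fin n → DistGen)
    (T : ℕ) (ω : Ω) : Submodule ℝ (EuclideanSpace ℝ (Fin d)) :=
  (Spaces.iter p τ η ψ (fun t => s.batch t ω) (fun t i => s.ζ t i ω) (fun t i => s.ζ' t i ω)
    T).primal

/-- Every algorithm within the abstract scheme with batch size `S` needs at least `N` oracle calls
(`S` in each iteration) on the problem `p` to output a random point `xbar` of the current primal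
space whose expected loss is at most `ε`. Here `loss` is nonnegative on the set `D` of admissible
outputs. The expectation is a Lebesgue integral, so it is meaningful (possibly infinite) for
every measurable `xbar`. -/
def NeedsCalls {n d : ℕ} (p : CFCCO n d) (S : ℕ) (D : Set (EuclideanSpace ℝ (Fin d)))
    (loss : EuclideanSpace ℝ (Fin d) → ℝ) (ε N : ℝ) : Prop :=
  ∀ (τ η : ℝ) (ψ : Fin n → DistGen), 0 < τ → 0 < η →
  ∀ (Ω : Type u) [MeasurableSpace Ω] (Pr : Measure Ω) [IsProbabilityMeasure Pr]
    (s : Sampling p S Pr) (T : ℕ) (xbar : Ω → EuclideanSpace ℝ (Fin d)), Measurable xbar →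
    (∀ᵐ ω ∂Pr, xbar ω ∈ s.primal τ η ψ T ω ∧ xbar ω ∈ D) →
    ∫⁻ ω, ENNReal.ofReal (loss (xbar ω)) ∂Pr ≤ ENNReal.ofReal ε →
    N ≤ (S : ℝ) * (T : ℝ)

/-! Both hard instances are unconstrained with regularizer `μ / 2 * ‖x‖ ^ 2`, so that the spaces of
the scheme can be followed exactly.

In the sparse instance the `i`-th inner function is `a * x i + m`. Its noise equals `-m` with
probability `1 - q`, so as long as `x i = 0` the algorithm sees the inner value `0`, the dual
variable of the block stays `0` and so does `x i`. Only the rare event can unlock the coordinate.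
Among the `S * T` sampled blocks it occurs `S * T * q` times in expectation, whereas an accurate
output needs about half of the `n` coordinates. The variance bound allows `q` of order
`m ^ 2 / σ0 ^ 2`; a Huber outer function permits `m ^ 2` of order `ε`, and `u ↦ Cf * max u 0`
permits `m` of order `ε`.

In the chain instance all inner functions equal a smoothing of `x ↦ max_j (x_j - σ * j)` over `k`
coordinates. A gradient reveals at most one new coordinate, hence so does an iteration, while the
minimizer has its mass spread over all `k` coordinates; `k` can be of order `1 / (μ * ε)`, and an
iteration costs `S` calls. -/

section ConvexAnalysis

variable {E : Type*} [NormedAddCommGroup E] [InnerProductSpace ℝ E]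

/-- `v` is a subgradient of `f : E → ℝ` at `x`, in the sense of convex analysis. -/
def IsSubgradient (f : E → ℝ) (x v : E) : Prop :=
  ∀ y, f x + inner ℝ v (y - x) ≤ f y

/-- `v` is a subgradient of `f` at `x` whose linearization is off by at most `L / 2 * ‖y - x‖ ^ 2`.
For an `L`-smooth convex function this holds at every point for `v = ∇ f x`; stating it with an
explicit `v` gives convexity, differentiability and the gradient at once. -/
def IsSmoothSubgradient (f : E → ℝ) (L : ℝ) (x v : E) : Prop :=
  IsSubgradient f x v ∧ ∀ y, f y ≤ f x + inner ℝ v (y - x) + L / 2 * ‖y - x‖ ^ 2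

variable {f : E → ℝ} {L a μ R : ℝ} {x v : E}

theorem IsSubgradient.const_mul (h : IsSubgradient f x v) (ha : 0 ≤ a) :
    IsSubgradient (fun y => a * f y) x (a • v) := fun y => by
  rw [real_inner_smul_left, ← mul_add]
  exact mul_le_mul_of_nonneg_left (h y) ha

theorem IsSubgradient.comp_mul_add_const {φ : ℝ → ℝ} {u θ m : ℝ}
    (h : IsSubgradient φ (a * u + m) θ) : IsSubgradient (fun t => φ (a * t + m)) u (a * θ) :=
  fun t => by
    have := h (a * t + m)
    simp only [RCLike.inner_apply, conj_trivial] at this ⊢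
    linarith

theorem IsSubgradient.add_sq_norm_le (h : IsSubgradient f x v) (hμ : 0 ≤ μ) (hv : v + μ • x = 0)
    (y : E) : f x + μ / 2 * ‖x‖ ^ 2 ≤ f y + μ / 2 * ‖y‖ ^ 2 := by
  have hxy := h y
  rw [eq_neg_of_add_eq_zero_left hv, inner_neg_left, real_inner_smul_left, inner_sub_right,
    real_inner_self_eq_norm_sq] at hxy
  have hsq : 0 ≤ μ / 2 * ‖x - y‖ ^ 2 := by positivity
  rw [norm_sub_sq_real] at hsq
  linarith

theorem convexOn_univ_of_exists_isSubgradient (h : ∀ x, ∃ v, IsSubgradient f x v) :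
    ConvexOn ℝ Set.univ f := by
  refine ⟨convex_univ, fun x _ y _ s t hs ht hst => ?_⟩
  obtain ⟨v, hv⟩ := h (s • x + t • y)
  have hx := mul_le_mul_of_nonneg_left (hv x) hs
  have hy := mul_le_mul_of_nonneg_left (hv y) ht
  simp only [inner_sub_right, inner_add_right, real_inner_smul_right] at hx hy
  obtain rfl : t = 1 - s := by linarith
  simp only [smul_eq_mul]
  linarith

theorem abs_sub_le_of_exists_isSubgradient (h : ∀ x, ∃ v, ‖v‖ ≤ R ∧ IsSubgradient f x v) (x y : E) :
    |f x - f y| ≤ R * ‖x - y‖ := by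
  have one_sided : ∀ x y, f x - f y ≤ R * ‖x - y‖ := fun x y => by
    obtain ⟨v, hvR, hv⟩ := h x
    have hinner : inner ℝ v (x - y) ≤ R * ‖x - y‖ :=
      (real_inner_le_norm _ _).trans (by gcongr)
    have hxy := hv y
    rw [← neg_sub x y, inner_neg_right] at hxy
    linarith
  exact abs_sub_le_iff.2 ⟨one_sided x y, norm_sub_rev x y ▸ one_sided y x⟩

theorem IsSmoothSubgradient.const_mul (h : IsSmoothSubgradient f L x v) (ha : 0 ≤ a) :
    IsSmoothSubgradient (fun y => a * f y) (a * L) x (a • v) := by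
  refine ⟨h.1.const_mul ha, fun y => ?_⟩
  have := mul_le_mul_of_nonneg_left (h.2 y) ha
  rw [real_inner_smul_left]
  linarith

theorem IsSmoothSubgradient.comp_sub_const {b : E} (h : IsSmoothSubgradient f L (x - b) v) :
    IsSmoothSubgradient (fun y => f (y - b)) L x v :=
  ⟨fun y => by simpa using h.1 (y - b), fun y => by simpa using h.2 (y - b)⟩

theorem IsSmoothSubgradient.hasGradientAt [CompleteSpace E] (h : IsSmoothSubgradient f L x v) :
    HasGradientAt f v x := by
  rw [hasGradientAt_iff_isLittleO]
  refine Asymptotics.IsBigO.trans_isLittleO (g := fun y => ‖y - x‖ ^ 2)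
    (.of_bound (L / 2) (.of_forall fun y => ?_)) ?_
  · rw [Real.norm_of_nonneg (by linarith [h.1 y]), Real.norm_of_nonneg (by positivity)]
    linarith [h.2 y]
  · exact Asymptotics.isLittleO_pow_sub_sub x one_lt_two

theorem outerSmooth_of_exists_isSmoothSubgradient {φ : ℝ → ℝ}
    (h : ∀ u, ∃ θ, IsSmoothSubgradient φ L u θ) : OuterSmooth φ L := by
  refine ⟨fun u => (h u).choose_spec.hasGradientAt.differentiableAt, fun u w => ?_⟩
  obtain ⟨θ, hθ⟩ := h w
  have hlower := hθ.1 u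
  have hupper := hθ.2 u
  simp only [RCLike.inner_apply, conj_trivial, Real.norm_eq_abs, sq_abs] at hlower hupper
  rw [hθ.hasGradientAt.hasDerivAt'.deriv, abs_of_nonneg (by linarith)]
  linarith

end ConvexAnalysis

section SmoothSupport

variable {E : Type*} [NormedAddCommGroup E] [InnerProductSpace ℝ E]

/-- `v` is the point of the convex set `K` nearest to `z`, characterized by the variational
inequality of the projection. -/
def IsNearestPoint (K : Set E) (z v : E) : Prop :=
  v ∈ K ∧ ∀ w ∈ K, inner ℝ (z - v) (w - v) ≤ 0

/-- Nesterov's smoothing of the support function `x ↦ sup_{q ∈ K} ⟪q, x⟫` with parameter `σ`. -/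
noncomputable def smoothSupport (K : Set E) (σ : ℝ) (x : E) : ℝ :=
  ⨆ q : K, (inner ℝ (q : E) x - σ / 2 * ‖(q : E)‖ ^ 2)

variable {K : Set E} {σ : ℝ} {x v q : E}

theorem exists_isNearestPoint (hne : K.Nonempty) (hK : IsComplete K) (hconv : Convex ℝ K) (z : E) :
    ∃ v, IsNearestPoint K z v := by
  obtain ⟨v, hv, h⟩ := exists_norm_eq_iInf_of_complete_convex hne hK hconv z
  exact ⟨v, hv, (norm_eq_iInf_iff_real_inner_le_zero hconv hv).1 h⟩

theorem isNearestPoint_self (hv : v ∈ K) : IsNearestPoint K v v :=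
  ⟨hv, fun w _ => by simp⟩

theorem le_smoothSupport (hσ : 0 < σ) (hq : q ∈ K) (x : E) :
    inner ℝ q x - σ / 2 * ‖q‖ ^ 2 ≤ smoothSupport K σ x := by
  refine le_ciSup (f := fun q : K => inner ℝ (q : E) x - σ / 2 * ‖(q : E)‖ ^ 2)
    ⟨(2 * σ)⁻¹ * ‖x‖ ^ 2, ?_⟩ ⟨q, hq⟩
  rintro _ ⟨w, rfl⟩
  have hsq : 0 ≤ σ / 2 * ‖(w : E) - σ⁻¹ • x‖ ^ 2 := by positivity
  rw [norm_sub_sq_real, real_inner_smul_right, norm_smul, Real.norm_eq_abs, mul_pow, sq_abs] at hsq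
  field_simp at hsq ⊢
  linarith

theorem IsNearestPoint.sub_sq_norm_le (h : IsNearestPoint K (σ⁻¹ • x) v) (hσ : 0 < σ) (hq : q ∈ K) :
    inner ℝ q x - σ / 2 * ‖q‖ ^ 2 + σ / 2 * ‖q - v‖ ^ 2 ≤ inner ℝ v x - σ / 2 * ‖v‖ ^ 2 := by
  have hvar := mul_nonpos_of_nonneg_of_nonpos hσ.le (h.2 q hq)
  rw [← real_inner_smul_left, smul_sub, smul_inv_smul₀ hσ.ne'] at hvar
  simp only [inner_sub_left, inner_sub_right, real_inner_smul_left,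
    real_inner_self_eq_norm_sq] at hvar
  rw [norm_sub_sq_real, real_inner_comm x q, real_inner_comm x v, real_inner_comm v q]
  linarith

theorem IsNearestPoint.smoothSupport_eq (h : IsNearestPoint K (σ⁻¹ • x) v) (hσ : 0 < σ) :
    smoothSupport K σ x = inner ℝ v x - σ / 2 * ‖v‖ ^ 2 := by
  have : Nonempty K := ⟨v, h.1⟩
  refine le_antisymm (ciSup_le fun q => ?_) (le_smoothSupport hσ h.1 x)
  have : 0 ≤ σ / 2 * ‖(q : E) - v‖ ^ 2 := by positivity
  linarith [h.sub_sq_norm_le hσ q.2]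

theorem IsNearestPoint.isSmoothSubgradient (h : IsNearestPoint K (σ⁻¹ • x) v) (hσ : 0 < σ) :
    IsSmoothSubgradient (smoothSupport K σ) σ⁻¹ x v := by
  have : Nonempty K := ⟨v, h.1⟩
  refine ⟨fun y => ?_, fun y => ciSup_le fun q => ?_⟩ <;>
    rw [h.smoothSupport_eq hσ, inner_sub_right]
  · linarith [le_smoothSupport hσ h.1 y]
  · have hsq : 0 ≤ σ / 2 * ‖(q - v : E) - σ⁻¹ • (y - x)‖ ^ 2 := by positivity
    rw [norm_sub_sq_real (q - v : E), real_inner_smul_right, norm_smul, Real.norm_eq_abs, mul_pow,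
      sq_abs] at hsq
    have hscale : σ / 2 * (‖(q - v : E)‖ ^ 2 - 2 * (σ⁻¹ * inner ℝ (q - v : E) (y - x))
        + σ⁻¹ ^ 2 * ‖y - x‖ ^ 2) = σ / 2 * ‖(q - v : E)‖ ^ 2 - inner ℝ (q - v : E) (y - x)
        + σ⁻¹ / 2 * ‖y - x‖ ^ 2 := by field_simp
    rw [hscale, inner_sub_left, inner_sub_right, inner_sub_right] at hsq
    linarith [h.sub_sq_norm_le hσ q.2]

theorem smoothSupport_nonneg (hσ : 0 < σ) (h0 : 0 ∈ K) (x : E) : 0 ≤ smoothSupport K σ x := by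
  simpa using le_smoothSupport hσ h0 x

theorem smoothSupport_zero (hσ : 0 < σ) (h0 : 0 ∈ K) : smoothSupport K σ 0 = 0 := by
  have hnear : IsNearestPoint K (σ⁻¹ • 0) 0 := by simpa using isNearestPoint_self h0
  simpa using hnear.smoothSupport_eq hσ

end SmoothSupport

theorem abs_le_of_mem_conjDom {f : ℝ → ℝ} {C v : ℝ} (hf : ∀ u u', |f u - f u'| ≤ C * |u - u'|)
    (hv : v ∈ conjDom f) : |v| ≤ C := by
  obtain ⟨M, hM⟩ := hv
  by_contra! hlt
  have hC : 0 ≤ C := by simpa using (abs_nonneg _).trans (hf 1 0)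
  have : 0 < |v| - C := by linarith
  have : 0 < |v| := by linarith
  have growth : ∀ t : ℝ, 0 ≤ t → t * (|v| * (|v| - C)) ≤ M + f 0 := fun t ht => by
    have hMt : v * (t * v) - f (t * v) ≤ M := hM ⟨t * v, rfl⟩
    have hft := (le_abs_self _).trans (hf (t * v) 0)
    rw [sub_zero, abs_mul, abs_of_nonneg ht] at hft
    linear_combination hMt + hft + t * abs_mul_abs_self v
  have hcontra := growth ((|M + f 0| + 1) / (|v| * (|v| - C))) (by positivity)
  rw [div_mul_cancel₀ _ (by positivity)] at hcontra
  linarith [le_abs_self (M + f 0)]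

theorem sum_norm_sub_mean_sq_le {ι E : Type*} [NormedAddCommGroup E] [InnerProductSpace ℝ E]
    (s : Finset ι) (v : ι → E) :
    ∑ j ∈ s, ‖v j - (1 / (s.card : ℝ)) • ∑ i ∈ s, v i‖ ^ 2 ≤ ∑ j ∈ s, ‖v j‖ ^ 2 := by
  rcases s.eq_empty_or_nonempty with rfl | hs
  · simp
  have : (0 : ℝ) < s.card := by exact_mod_cast hs.card_pos
  have variance_eq : ∑ j ∈ s, ‖v j - (1 / (s.card : ℝ)) • ∑ i ∈ s, v i‖ ^ 2
      = ∑ j ∈ s, ‖v j‖ ^ 2 - (1 / (s.card : ℝ)) * ‖∑ i ∈ s, v i‖ ^ 2 := by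
    simp only [norm_sub_sq_real, Finset.sum_add_distrib, Finset.sum_sub_distrib, Finset.sum_const,
      nsmul_eq_mul, ← Finset.mul_sum, ← sum_inner, real_inner_smul_right,
      real_inner_self_eq_norm_sq, norm_smul, Real.norm_eq_abs, mul_pow, sq_abs]
    field_simp
    ring
  rw [variance_eq]
  exact sub_le_self _ (by positivity)

theorem mean_norm_sub_mean_sq_le {E : Type*} [NormedAddCommGroup E] [InnerProductSpace ℝ E]
    {n : ℕ} {v : Fin n → E} {δ : ℝ} (hv : ∀ j, ‖v j‖ ≤ δ) :
    (1 / (n : ℝ)) * ∑ j, ‖v j - (1 / (n : ℝ)) • ∑ i, v i‖ ^ 2 ≤ δ ^ 2 := by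
  have hsum : ∑ j, ‖v j - (1 / (n : ℝ)) • ∑ i, v i‖ ^ 2 ≤ n * δ ^ 2 :=
    calc ∑ j, ‖v j - (1 / (n : ℝ)) • ∑ i, v i‖ ^ 2
        ≤ ∑ j, ‖v j‖ ^ 2 := by simpa using sum_norm_sub_mean_sq_le Finset.univ v
      _ ≤ ∑ _ : Fin n, δ ^ 2 := by gcongr with j; exact hv j
      _ = n * δ ^ 2 := by simp
  rw [one_div_mul_eq_div]
  exact div_le_of_le_mul₀ (Nat.cast_nonneg n) (sq_nonneg δ) (by linarith)

theorem mean_norm_smul_sub_mean_sq_le {E : Type*} [NormedAddCommGroup E] [InnerProductSpace ℝ E]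
    {n : ℕ} {v : Fin n → E} {y : Fin n → ℝ} {a b δ : ℝ} (hy : ∀ j, |y j| ≤ b) (hb : 0 ≤ b)
    (hv : ∀ j, ‖v j‖ ≤ a) (hab : b * a ≤ δ) :
    (1 / (n : ℝ)) * ∑ j, ‖y j • v j - (1 / (n : ℝ)) • ∑ i, y i • v i‖ ^ 2 ≤ δ ^ 2 :=
  mean_norm_sub_mean_sq_le fun j => by
    rw [norm_smul, Real.norm_eq_abs]
    exact (mul_le_mul (hy j) (hv j) (norm_nonneg _) hb).trans hab

section RidgeProblem

/-- `P` is the law of a centred noise on `ℝ` with standard deviation at most `σ`. -/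
structure IsCenteredNoise (P : Measure ℝ) (σ : ℝ) : Prop where
  isProbabilityMeasure : IsProbabilityMeasure P
  integrable_id : Integrable (fun z => z) P
  integral_id : ∫ z, z ∂P = 0
  lintegral_sq_le : ∫⁻ z, ENNReal.ofReal (z ^ 2) ∂P ≤ ENNReal.ofReal (σ ^ 2)

/-- The unconstrained problem with outer functions `f`, regularizer `μ / 2 * ‖x‖ ^ 2` and inner
functions `G i` observed with an additive noise of law `P`, so that all gradients are exact. Both
hard instances have this form. -/
noncomputable def ridgeProblem {n d : ℕ} (f : ℝ → ℝ) (G : Fin n → EuclideanSpace ℝ (Fin d) → ℝ)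
    (P : Measure ℝ) (μ : ℝ) : CFCCO n d where
  X := Set.univ
  r := fun x => μ / 2 * ‖x‖ ^ 2
  f := fun _ => f
  Z := ℝ
  mZ := inferInstance
  P := fun _ => P
  g := fun i x z => G i x + z

variable {n d : ℕ} {f : ℝ → ℝ} {G : Fin n → EuclideanSpace ℝ (Fin d) → ℝ} {P : Measure ℝ}
  {Cf Cg σ0 σ1 δ μ a L : ℝ}

theorem IsSmoothSubgradient.hasGradientAt_ridgeProblem_g {i : Fin n}
    {x v : EuclideanSpace ℝ (Fin d)} (h : IsSmoothSubgradient (G i) L x v) (z : ℝ) :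
    HasGradientAt (fun x' => (ridgeProblem f G P μ).g i x' z) v x := by
  refine IsSmoothSubgradient.hasGradientAt (L := L) ⟨fun y => ?_, fun y => ?_⟩
  · change G i x + z + inner ℝ v (y - x) ≤ G i y + z
    linarith [h.1 y]
  · change G i y + z ≤ G i x + z + inner ℝ v (y - x) + L / 2 * ‖y - x‖ ^ 2
    linarith [h.2 y]

theorem ridgeProblem_mean (hP : IsCenteredNoise P σ0) (i : Fin n) :
    (ridgeProblem f G P μ).mean i = G i := by
  have := hP.isProbabilityMeasure
  funext x
  change ∫ z, (G i x + z) ∂P = G i x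
  rw [integral_add (integrable_const _) hP.integrable_id, hP.integral_id]
  simp

theorem ridgeProblem_F (hP : IsCenteredNoise P σ0) (x : EuclideanSpace ℝ (Fin d)) :
    (ridgeProblem f G P μ).F x = (1 / (n : ℝ)) * ∑ i, f (G i x) + μ / 2 * ‖x‖ ^ 2 := by
  simp only [CFCCO.F, ridgeProblem_mean hP]
  rfl

theorem ridgeProblem_inClass (hP : IsCenteredNoise P σ0) (hCf : 0 ≤ Cf) (haCg : a ≤ Cg)
    (haδ : Cf * a ≤ δ) (hG : ∀ i x, ∃ v, ‖v‖ ≤ a ∧ IsSmoothSubgradient (G i) L x v)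
    (hf : ∀ u, ∃ θ, |θ| ≤ Cf ∧ IsSubgradient f u θ)
    (hmono : ∀ i, (∃ (A : EuclideanSpace ℝ (Fin d) →L[ℝ] ℝ) (b : ℝ), ∀ x, G i x = A x + b) ∨
      Monotone f) :
    (ridgeProblem f G P μ).InClass Cf Cg σ0 σ1 δ μ := by
  have hmean := ridgeProblem_mean (n := n) (f := f) (G := G) (μ := μ) hP
  have f_lip : ∀ u u', |f u - f u'| ≤ Cf * |u - u'| := abs_sub_le_of_exists_isSubgradient hf
  choose D hDa hD using hG
  have g_grad : ∀ i z x, HasGradientAt (fun x' => (ridgeProblem f G P μ).g i x' z) (D i x) x :=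
    fun i z x => (hD i x).hasGradientAt_ridgeProblem_g z
  have G_grad : ∀ i x, gradient (G i) x = D i x := fun i x => (hD i x).hasGradientAt.gradient
  exact
  { X_closed := isClosed_univ
    X_convex := convex_univ
    X_zero := Set.mem_univ _
    r_lsc := (by fun_prop : Continuous fun x : EuclideanSpace ℝ (Fin d) =>
      μ / 2 * ‖x‖ ^ 2).lowerSemicontinuous.lowerSemicontinuousOn _
    r_convex := strongConvexOn_iff_convex.2 <| by
      simpa [ridgeProblem] using convexOn_const (0 : ℝ) convex_univ
    prob := fun _ => hP.isProbabilityMeasure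
    g_integrable := fun i x =>
      have := hP.isProbabilityMeasure
      (integrable_const (μ := P) (G i x)).add hP.integrable_id
    g_diff := fun i z x => (g_grad i z x).differentiableAt
    mean_diff := fun i x => by
      rw [hmean]
      exact (hD i x).hasGradientAt.differentiableAt
    mean_convex := fun i => by
      rw [hmean]
      exact convexOn_univ_of_exists_isSubgradient fun x => ⟨D i x, (hD i x).1⟩
    mean_lip := fun i x x' => by
      rw [hmean]
      exact abs_sub_le_of_exists_isSubgradient
        (fun y => ⟨D i y, (hDa i y).trans haCg, (hD i y).1⟩) x x'
    f_convex := fun _ => convexOn_univ_of_exists_isSubgradient fun u => (hf u).imp fun _ h => h.2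
    f_lip := fun _ => f_lip
    f_mono := fun i => by
      rw [hmean]
      exact hmono i
    var_zero := fun i x => by
      rw [hmean]
      change ∫⁻ z, ENNReal.ofReal ((G i x - (G i x + z)) ^ 2) ∂P ≤ _
      simpa using hP.lintegral_sq_le
    var_one := fun i x => by simp [hmean, G_grad, fun z => (g_grad i z x).gradient]
    var_block := fun x y hy => by
      simp only [hmean, G_grad]
      exact mean_norm_smul_sub_mean_sq_le (fun j => abs_le_of_mem_conjDom f_lip (hy j)) hCf
        (fun j => hDa j x) haδ }

theorem eq_smul_of_isQP_ridgeProblem {η : ℝ} {x₀ H x : EuclideanSpace ℝ (Fin d)}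
    (hs : 0 < μ + η) (h : (ridgeProblem f G P μ).IsQP η x₀ H x) :
    x = (μ + η)⁻¹ • (η • x₀ - H) := by
  set y := (μ + η)⁻¹ • (η • x₀ - H) with hy
  have hH : H = η • x₀ - (μ + η) • y := by
    rw [hy, smul_inv_smul₀ hs.ne', sub_sub_cancel]
  have complete_square : ∀ w, inner ℝ w H + μ / 2 * ‖w‖ ^ 2 + η / 2 * ‖w - x₀‖ ^ 2
      = (η / 2 * ‖x₀‖ ^ 2 - (μ + η) / 2 * ‖y‖ ^ 2) + (μ + η) / 2 * ‖w - y‖ ^ 2 := fun w => by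
    rw [hH]
    simp only [norm_sub_sq_real, inner_sub_right, inner_smul_right]
    ring
  have hle : inner ℝ x H + μ / 2 * ‖x‖ ^ 2 + η / 2 * ‖x - x₀‖ ^ 2
      ≤ inner ℝ y H + μ / 2 * ‖y‖ ^ 2 + η / 2 * ‖y - x₀‖ ^ 2 := h.2 (Set.mem_univ y)
  rw [complete_square, complete_square, sub_self, norm_zero] at hle
  have hdist : ‖x - y‖ ^ 2 ≤ 0 := nonpos_of_mul_nonpos_right (by linarith) (half_pos hs)
  exact sub_eq_zero.1 (norm_eq_zero.1 (sq_nonpos_iff _ |>.1 hdist))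

end RidgeProblem

section Scheme

variable {n d : ℕ} {p : CFCCO n d} {B : Finset (Fin n)} {z z' : Fin n → p.Z} {s : Spaces n d}

theorem isMP_zero_zero {f : ℝ → ℝ} {ψ : DistGen} {τ v : ℝ} (hτ : 0 < τ) (hf : ∀ u, 0 ≤ f u)
    (hf0 : f 0 = 0) (h : IsMP f ψ τ 0 0 v) : v = 0 := by
  obtain ⟨q, ⟨h0, hq⟩, ⟨hv, hvψ⟩, hmax⟩ := h
  have zero_mem : (0 : ℝ) ∈ conjDom f := ⟨0, by rintro _ ⟨u, rfl⟩; simpa using hf u⟩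
  have conj_zero : fenchelConj f 0 ≤ 0 := ciSup_le fun u => by simpa using hf u
  have conj_nonneg : 0 ≤ fenchelConj f v := by simpa [fenchelConj, hf0] using le_ciSup hv 0
  have hle := hmax ⟨zero_mem, h0⟩
  simp only [Set.mem_ofPred_eq, DistGen.bregman, mul_zero, sub_zero, sub_self] at hle
  have bregman_nonpos : ψ.fn v - ψ.fn 0 - q * v ≤ 0 :=
    nonpos_of_mul_nonpos_right (by linarith) hτ
  by_contra hne
  have hhalf : (0 : ℝ) < 1 / 2 := by norm_num
  have hstrict := ψ.strict.2 hvψ h0 hne hhalf hhalf (by norm_num)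
  have htangent := hq _ (ψ.strict.1 hvψ h0 hhalf.le hhalf.le (by norm_num))
  simp only [smul_eq_mul, mul_zero, add_zero, sub_zero] at hstrict htangent
  linarith

theorem Spaces.nextInn_eq_bot {i : Fin n} (hs : s.inn i = ⊥)
    (hg : i ∈ B → ∀ x ∈ s.primal, p.g i x (z i) = 0) : nextInn p B z s i = ⊥ := by
  unfold nextInn
  split_ifs with hi
  · rw [hs, bot_sup_eq, Submodule.span_eq_bot]
    rintro _ ⟨x, hx, rfl⟩
    exact hg hi x hx
  · exact hs

theorem Spaces.nextDual_eq_bot {τ : ℝ} {ψ : Fin n → DistGen} {inn' : Fin n → Submodule ℝ ℝ}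
    {i : Fin n} (hτ : 0 < τ) (hf : ∀ u, 0 ≤ p.f i u) (hf0 : p.f i 0 = 0) (hs : s.dual i = ⊥)
    (hinn : inn' i = ⊥) : nextDual p τ ψ B inn' s i = ⊥ := by
  unfold nextDual
  split_ifs
  · rw [hs, hinn, bot_sup_eq, Submodule.span_eq_bot]
    rintro v ⟨y, rfl, γ, rfl, hv⟩
    exact isMP_zero_zero hτ hf hf0 hv
  · exact hs

theorem Spaces.nextGrad_le {dual' : Fin n → Submodule ℝ ℝ}
    {V : Submodule ℝ (EuclideanSpace ℝ (Fin d))} (hs : s.grad ≤ V)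
    (hV : ∀ x ∈ s.primal, ∀ i, ∀ y ∈ dual' i, y • gradient (fun x' => p.g i x' (z' i)) x ∈ V) :
    nextGrad p B z' dual' s ≤ V := by
  refine sup_le hs (Submodule.span_le.2 ?_)
  rintro _ ⟨x, hx, y, hy, rfl⟩
  exact V.smul_mem _ (V.sum_mem fun i _ => hV x hx i (y i) (hy i))

theorem nextPrimal_ridgeProblem_le {f : ℝ → ℝ} {G : Fin n → EuclideanSpace ℝ (Fin d) → ℝ}
    {P : Measure ℝ} {μ η : ℝ} {V grad' : Submodule ℝ (EuclideanSpace ℝ (Fin d))} (hs : 0 < μ + η)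
    (hV : s.primal ≤ V) (hgrad : grad' ≤ V) :
    Spaces.nextPrimal (ridgeProblem f G P μ) η grad' s ≤ V := by
  refine sup_le hV (Submodule.span_le.2 ?_)
  rintro x ⟨x₀, hx₀, H, hH, hx⟩
  rw [SetLike.mem_coe, eq_smul_of_isQP_ridgeProblem hs hx]
  exact V.smul_mem _ (V.sub_mem (V.smul_mem _ (hV hx₀)) (hgrad hH))

end Scheme

section RareEvents

variable {n d S : ℕ}

open Classical in
/-- The number of pairs of an iteration before `T` and a block of its batch for which the sample
of the block lies in its set `A i`. With rare events `A i`, this bounds what the scheme can have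
learned. -/
noncomputable def rareHits {Z : Type*} (A : Fin n → Set Z) (B : ℕ → Finset (Fin n))
    (z : ℕ → Fin n → Z) (T : ℕ) : ℕ :=
  ∑ t ∈ Finset.range T, {i ∈ B t | z t i ∈ A i}.card

variable {p : CFCCO n d} {Ω : Type u} [MeasurableSpace Ω] {Pr : Measure Ω}

theorem Sampling.measurableSet_mem_batch (s : Sampling p S Pr) (t : ℕ) (i : Fin n) :
    MeasurableSet {ω | i ∈ s.batch t ω} :=
  s.batch_meas t (Set.toFinite {B : Finset (Fin n) | i ∈ B}).measurableSet

theorem Sampling.measure_mem_batch_and (s : Sampling p S Pr) (t : ℕ) (i : Fin n) {A : Set p.Z}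
    (hA : MeasurableSet A) :
    Pr {ω | i ∈ s.batch t ω ∧ s.ζ t i ω ∈ A} = Pr {ω | i ∈ s.batch t ω} * p.P i A := by
  have hindep : IndepFun (s.batch t) (s.ζ t i) Pr :=
    (s.batch_indep t i).comp measurable_id measurable_fst
  rw [← s.ζ_law t i, Measure.map_apply (s.ζ_meas t i) hA]
  exact hindep.measure_inter_preimage_eq_mul {B | i ∈ B} A (Set.toFinite _).measurableSet hA

theorem Sampling.sum_measure_mem_batch [IsProbabilityMeasure Pr] (s : Sampling p S Pr) (t : ℕ) :
    ∑ i, Pr {ω | i ∈ s.batch t ω} = S :=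
  calc ∑ i, Pr {ω | i ∈ s.batch t ω}
      = ∑ i, ∫⁻ ω, {ω | i ∈ s.batch t ω}.indicator 1 ω ∂Pr := by
        simp only [lintegral_indicator_one (s.measurableSet_mem_batch t _)]
    _ = ∫⁻ ω, ∑ i, {ω | i ∈ s.batch t ω}.indicator 1 ω ∂Pr :=
        (lintegral_finsetSum _ fun i _ =>
          measurable_one.indicator (s.measurableSet_mem_batch t i)).symm
    _ = ∫⁻ _, (S : ENNReal) ∂Pr := by
        congr with ω
        simp [Set.indicator_apply, ← s.batch_card t ω]
    _ = S := by simp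

theorem Sampling.natCast_rareHits (s : Sampling p S Pr) (A : Fin n → Set p.Z) (T : ℕ) (ω : Ω) :
    (rareHits A (s.batch · ω) (s.ζ · · ω) T : ENNReal) = ∑ t ∈ Finset.range T, ∑ i,
      {ω | i ∈ s.batch t ω ∧ s.ζ t i ω ∈ A i}.indicator 1 ω := by
  classical
  simp only [rareHits, Nat.cast_sum, Finset.natCast_card_filter, Set.indicator_apply,
    Set.mem_ofPred_eq, ite_and, Pi.one_apply, Finset.sum_ite_mem, Finset.univ_inter]

theorem Sampling.measurableSet_mem_batch_and (s : Sampling p S Pr) (t : ℕ) (i : Fin n)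
    {A : Set p.Z} (hA : MeasurableSet A) :
    MeasurableSet {ω | i ∈ s.batch t ω ∧ s.ζ t i ω ∈ A} :=
  (s.measurableSet_mem_batch t i).inter (s.ζ_meas t i hA)

theorem Sampling.measurable_rareHits (s : Sampling p S Pr) {A : Fin n → Set p.Z}
    (hA : ∀ i, MeasurableSet (A i)) (T : ℕ) :
    Measurable fun ω => (rareHits A (s.batch · ω) (s.ζ · · ω) T : ENNReal) := by
  simp only [s.natCast_rareHits]
  exact Finset.measurable_fun_sum _ fun t _ => Finset.measurable_fun_sum _ fun i _ =>
    measurable_one.indicator (s.measurableSet_mem_batch_and t i (hA i))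

theorem Sampling.lintegral_rareHits_le [IsProbabilityMeasure Pr] (s : Sampling p S Pr)
    {A : Fin n → Set p.Z} {q : ENNReal} (hA : ∀ i, MeasurableSet (A i))
    (hq : ∀ i, p.P i (A i) ≤ q) (T : ℕ) :
    ∫⁻ ω, (rareHits A (s.batch · ω) (s.ζ · · ω) T : ENNReal) ∂Pr ≤ T * (S * q) := by
  have indicator_meas : ∀ t i, Measurable
      ({ω | i ∈ s.batch t ω ∧ s.ζ t i ω ∈ A i}.indicator (1 : Ω → ENNReal)) := fun t i =>
    measurable_one.indicator (s.measurableSet_mem_batch_and t i (hA i))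
  calc ∫⁻ ω, (rareHits A (s.batch · ω) (s.ζ · · ω) T : ENNReal) ∂Pr
      = ∑ t ∈ Finset.range T, ∑ i, Pr {ω | i ∈ s.batch t ω ∧ s.ζ t i ω ∈ A i} := by
        simp only [s.natCast_rareHits]
        rw [lintegral_finsetSum _ fun t _ =>
          Finset.measurable_fun_sum _ fun i _ => indicator_meas t i]
        simp only [lintegral_finsetSum _ fun i _ => indicator_meas _ i,
          lintegral_indicator_one (s.measurableSet_mem_batch_and _ _ (hA _))]
    _ ≤ ∑ t ∈ Finset.range T, ∑ i, Pr {ω | i ∈ s.batch t ω} * q := by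
        gcongr with t _ i
        rw [s.measure_mem_batch_and t i (hA i)]
        gcongr
        exact hq i
    _ = T * (S * q) := by simp [← Finset.sum_mul, s.sum_measure_mem_batch]

theorem needsCalls_of_le_loss_add_rareHits {A : Fin n → Set p.Z} {q ε ℓ : ℝ}
    {D : Set (EuclideanSpace ℝ (Fin d))} {loss : EuclideanSpace ℝ (Fin d) → ℝ} (hn : 0 < n)
    (hA : ∀ i, MeasurableSet (A i)) (hq : 0 < q) (hPA : ∀ i, p.P i (A i) ≤ ENNReal.ofReal q)
    (hε : 0 < ε) (hℓ : 2 * ε ≤ ℓ)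
    (hloss : ∀ (τ η : ℝ) (ψ : Fin n → DistGen), 0 < τ → 0 < η →
      ∀ (B : ℕ → Finset (Fin n)) (z z' : ℕ → Fin n → p.Z) (T : ℕ),
      ∀ x ∈ (Spaces.iter p τ η ψ B z z' T).primal, x ∈ D →
        ℓ ≤ loss x + ℓ / n * rareHits A B z T) :
    NeedsCalls.{u} p S D loss ε (n / (2 * q)) := by
  intro τ η ψ hτ hη Ω _ Pr _ s T xbar _ hmem hexp
  have : (0 : ℝ) < n := by exact_mod_cast hn
  have : 0 < ℓ := by linarith
  have expected : ENNReal.ofReal ℓ ≤ ENNReal.ofReal (ε + ℓ / n * (T * (S * q))) :=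
    calc ENNReal.ofReal ℓ = ∫⁻ _, ENNReal.ofReal ℓ ∂Pr := by simp
      _ ≤ ∫⁻ ω, (ENNReal.ofReal (loss (xbar ω)) +
            ENNReal.ofReal (ℓ / n) * rareHits A (s.batch · ω) (s.ζ · · ω) T) ∂Pr := by
          refine lintegral_mono_ae ?_
          filter_upwards [hmem] with ω hω
          rw [← ENNReal.ofReal_natCast, ← ENNReal.ofReal_mul (by positivity)]
          exact (ENNReal.ofReal_le_ofReal (hloss τ η ψ hτ hη _ _ _ T _ hω.1 hω.2)).trans
            ENNReal.ofReal_add_le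
      _ ≤ ENNReal.ofReal ε + ENNReal.ofReal (ℓ / n) * (T * (S * ENNReal.ofReal q)) := by
          have hmeas := s.measurable_rareHits hA T
          rw [lintegral_add_right _ (hmeas.const_mul _), lintegral_const_mul _ hmeas]
          gcongr
          exact s.lintegral_rareHits_le hA hPA T
      _ = ENNReal.ofReal (ε + ℓ / n * (T * (S * q))) := by
          rw [← ENNReal.ofReal_natCast, ← ENNReal.ofReal_natCast,
            ← ENNReal.ofReal_mul (by positivity), ← ENNReal.ofReal_mul (by positivity),
            ← ENNReal.ofReal_mul (by positivity), ← ENNReal.ofReal_add (by positivity)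
            (by positivity)]
  rw [ENNReal.ofReal_le_ofReal_iff (by positivity)] at expected
  have half_le : ℓ / n * (n / 2) ≤ ℓ / n * (T * (S * q)) := by
    rw [show ℓ / n * (n / 2) = ℓ / 2 by field_simp]
    linarith
  have := le_of_mul_le_mul_left half_le (by positivity)
  rw [div_le_iff₀ (by positivity)]
  linarith

end RareEvents

section SparseProblem

/-- The law of a centred noise taking the value `-m` with probability `1 - q`. Added to an inner
function that equals `m` at the origin, it makes the origin look like a zero of the inner function
except with the small probability `q`. -/
noncomputable def maskingNoise (m : ℝ) (q : unitInterval) : Measure ℝ :=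
  bernoulliMeasure (m / q - m) (-m) q

variable {n : ℕ} {f h : ℝ → ℝ} {a m μ ε θ v : ℝ} {q : unitInterval}

theorem isCenteredNoise_maskingNoise {σ : ℝ} (hq : 0 < (q : ℝ)) (hm : m ^ 2 ≤ q * σ ^ 2) :
    IsCenteredNoise (maskingNoise m q) σ where
  isProbabilityMeasure := by unfold maskingNoise; infer_instance
  integrable_id := integrable_bernoulliMeasure _ _ _ _
  integral_id := by
    rw [maskingNoise, integral_bernoulliMeasure, smul_eq_mul, smul_eq_mul]
    field_simp
    ring
  lintegral_sq_le := by
    rw [maskingNoise, ← ofReal_integral_eq_lintegral_ofReal (integrable_bernoulliMeasure _ _ _ _)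
      (.of_forall fun z => sq_nonneg z), integral_bernoulliMeasure, smul_eq_mul, smul_eq_mul]
    refine ENNReal.ofReal_le_ofReal ?_
    calc (q : ℝ) * (m / q - m) ^ 2 + (1 - q) * (-m) ^ 2 = m ^ 2 / q - m ^ 2 := by
          field_simp
          ring
      _ ≤ m ^ 2 / q := sub_le_self _ (sq_nonneg m)
      _ ≤ σ ^ 2 := (div_le_iff₀' hq).2 hm

theorem maskingNoise_compl_le : maskingNoise m q {-m}ᶜ ≤ ENNReal.ofReal q := by
  classical
  rw [maskingNoise, bernoulliMeasure_apply q (measurableSet_singleton _).compl,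
    ENNReal.ofReal_eq_coe_nnreal q.2.1]
  split_ifs with _ h
  · exact absurd rfl h
  · exact le_rfl
  · exact absurd rfl ‹_›
  · exact zero_le

/-- The problem on `ℝⁿ` whose `i`-th inner function `a * x i + m` depends on the `i`-th
coordinate only and is observed through `maskingNoise`. -/
noncomputable def sparseProblem (n : ℕ) (f : ℝ → ℝ) (a m : ℝ) (q : unitInterval) (μ : ℝ) :
    CFCCO n n :=
  ridgeProblem f (fun i x => a * x i + m) (maskingNoise m q) μ

theorem isSmoothSubgradient_mul_apply_add (i : Fin n) (x : EuclideanSpace ℝ (Fin n)) :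
    IsSmoothSubgradient (fun x : EuclideanSpace ℝ (Fin n) => a * x i + m) 0 x
      (a • EuclideanSpace.single i 1) := by
  have tangent_eq : ∀ y : EuclideanSpace ℝ (Fin n),
      a * x i + m + inner ℝ (a • EuclideanSpace.single i 1) (y - x) = a * y i + m := fun y => by
    simp [inner_smul_left, EuclideanSpace.inner_single_left]
    ring
  exact ⟨fun y => (tangent_eq y).le, fun y => by rw [tangent_eq]; simp⟩

theorem sparseProblem_inClass {Cf Cg σ0 σ1 δ : ℝ} (hq : 0 < (q : ℝ)) (hm : m ^ 2 ≤ q * σ0 ^ 2)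
    (hCf : 0 ≤ Cf) (ha : 0 ≤ a) (haCg : a ≤ Cg) (haδ : Cf * a ≤ δ)
    (hf : ∀ u, ∃ θ, |θ| ≤ Cf ∧ IsSubgradient f u θ) :
    (sparseProblem n f a m q μ).InClass Cf Cg σ0 σ1 δ μ :=
  ridgeProblem_inClass (isCenteredNoise_maskingNoise hq hm) hCf haCg haδ
    (fun i x => ⟨_, by simp [norm_smul, abs_of_nonneg ha], isSmoothSubgradient_mul_apply_add i x⟩)
    hf (fun i => .inl ⟨a • EuclideanSpace.proj i, m, fun x => rfl⟩)

theorem sparseProblem_F {σ : ℝ} (hn : 0 < n) (hq : 0 < (q : ℝ)) (hm : m ^ 2 ≤ q * σ ^ 2)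
    (x : EuclideanSpace ℝ (Fin n)) :
    (sparseProblem n f a m q μ).F x
      = 1 / n * ∑ i, (f (a * x i + m) + n * μ / 2 * ‖x i‖ ^ 2) := by
  have : (n : ℝ) ≠ 0 := by exact_mod_cast hn.ne'
  rw [sparseProblem, ridgeProblem_F (isCenteredNoise_maskingNoise hq hm), EuclideanSpace.norm_sq_eq,
    Finset.sum_add_distrib, ← Finset.mul_sum]
  field_simp

theorem IsSubgradient.le_of_mul_add_mul_eq_zero (h : IsSubgradient f (a * v + m) θ) (hμ : 0 ≤ μ)
    (hv : a * θ + μ * v = 0) (u : ℝ) :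
    f (a * v + m) + μ / 2 * ‖v‖ ^ 2 ≤ f (a * u + m) + μ / 2 * ‖u‖ ^ 2 :=
  h.comp_mul_add_const.add_sq_norm_le hμ hv u

theorem sparseProblem_isMinimizer {σ : ℝ} (hn : 0 < n) (hq : 0 < (q : ℝ))
    (hm : m ^ 2 ≤ q * σ ^ 2) (hμ : 0 ≤ μ) (h : IsSubgradient f (a * v + m) θ)
    (hv : a * θ + n * μ * v = 0) :
    (sparseProblem n f a m q μ).IsMinimizer (WithLp.toLp 2 fun _ => v) := by
  refine ⟨Set.mem_univ _, fun x _ => ?_⟩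
  simp only [Set.mem_ofPred_eq, sparseProblem_F hn hq hm]
  gcongr (1 / (n : ℝ)) * ∑ i, ?_ with i
  exact h.le_of_mul_add_mul_eq_zero (by positivity) hv (x i)

variable {τ η : ℝ} {ψ : Fin n → DistGen} {B : ℕ → Finset (Fin n)} {z z' : ℕ → Fin n → ℝ}

/- A block whose noise has always been `-m` has only seen the inner value `0`, so its dual variable
is still `0` and it has not contributed to the gradient estimators, which are the only source of
its coordinate. -/
theorem sparseProblem_apply_eq_zero (hτ : 0 < τ) (hμη : 0 < μ + η) (hf : ∀ u, 0 ≤ f u)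
    (hf0 : f 0 = 0) {i : Fin n} {T : ℕ} (hz : ∀ t < T, i ∈ B t → z t i = -m)
    {x : EuclideanSpace ℝ (Fin n)}
    (hx : x ∈ (Spaces.iter (sparseProblem n f a m q μ) τ η ψ B z z' T).primal) : x i = 0 := by
  let p := sparseProblem n f a m q μ
  let V := (EuclideanSpace.proj i : EuclideanSpace ℝ (Fin n) →L[ℝ] ℝ).ker
  suffices hiter : ∀ t ≤ T, let s := Spaces.iter p τ η ψ B z z' t
      s.inn i = ⊥ ∧ s.dual i = ⊥ ∧ s.grad ≤ V ∧ s.primal ≤ V from (hiter T le_rfl).2.2.2 hx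
  intro t
  induction t with
  | zero => exact fun _ => ⟨rfl, rfl, bot_le, bot_le⟩
  | succ t ih =>
    intro ht
    obtain ⟨inn_eq, dual_eq, grad_le, primal_le⟩ := ih (by lia)
    set s := Spaces.iter p τ η ψ B z z' t
    let inn' := Spaces.nextInn p (B t) (z t) s
    let dual' := Spaces.nextDual p τ ψ (B t) inn' s
    have inn_eq' : inn' i = ⊥ := Spaces.nextInn_eq_bot inn_eq fun hi x hx => by
      have hxi : x i = 0 := primal_le hx
      change a * x i + m + z t i = 0
      rw [hxi, hz t (by lia) hi]
      ring
    have dual_eq' : dual' i = ⊥ := Spaces.nextDual_eq_bot hτ hf hf0 dual_eq inn_eq'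
    have grad_le' : Spaces.nextGrad p (B t) (z' t) dual' s ≤ V := by
      refine Spaces.nextGrad_le grad_le fun x _ j y hy => ?_
      have grad_eq : gradient (fun x' => p.g j x' (z' t j)) x = a • EuclideanSpace.single j 1 :=
        ((isSmoothSubgradient_mul_apply_add j x).hasGradientAt_ridgeProblem_g _).gradient
      rw [grad_eq]
      obtain rfl | hji := eq_or_ne j i
      · rw [dual_eq', Submodule.mem_bot] at hy
        simp [hy]
      · simp [V, hji.symm]
    exact ⟨inn_eq', dual_eq', grad_le', nextPrimal_ridgeProblem_le hμη primal_le grad_le'⟩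

open Classical in
theorem card_ne_zero_le_rareHits (hτ : 0 < τ) (hμη : 0 < μ + η) (hf : ∀ u, 0 ≤ f u)
    (hf0 : f 0 = 0) {T : ℕ} {x : EuclideanSpace ℝ (Fin n)}
    (hx : x ∈ (Spaces.iter (sparseProblem n f a m q μ) τ η ψ B z z' T).primal) :
    Finset.card {i | x i ≠ 0} ≤ rareHits (fun _ => {-m}ᶜ) B z T := by
  refine le_trans (Finset.card_le_card fun i hi => ?_) Finset.card_biUnion_le
  by_contra hmem
  simp only [Finset.mem_biUnion, Finset.mem_range, Finset.mem_filter, Set.mem_compl_singleton_iff,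
    not_exists, not_and, not_not] at hmem
  exact (Finset.mem_filter.1 hi).2 (sparseProblem_apply_eq_zero hτ hμη hf hf0 hmem hx)

theorem sparseProblem_needsCalls {S : ℕ} {D : Set (EuclideanSpace ℝ (Fin n))}
    {loss : EuclideanSpace ℝ (Fin n) → ℝ} (hn : 0 < n) (hq : 0 < (q : ℝ)) (hμ : 0 ≤ μ)
    (hf : ∀ u, 0 ≤ f u) (hf0 : f 0 = 0) (hε : 0 < ε)
    (hloss : ∀ x, loss x = 1 / n * ∑ i, h (x i)) (hh : ∀ u, 0 ≤ h u) (hh0 : 2 * ε ≤ h 0) :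
    NeedsCalls.{u} (sparseProblem n f a m q μ) S D loss ε (n / (2 * q)) := by
  refine needsCalls_of_le_loss_add_rareHits (A := fun _ => ({-m}ᶜ : Set ℝ)) hn
    (fun _ => (measurableSet_singleton (-m : ℝ)).compl) hq (fun _ => maskingNoise_compl_le)
    hε hh0 fun τ η ψ hτ hη B z z' T x hx _ => ?_
  classical
  have : (0 : ℝ) < n := by exact_mod_cast hn
  calc h 0 = 1 / n * ∑ _i : Fin n, h 0 := by simp; field_simp
    _ ≤ 1 / n * ∑ i, (h (x i) + h 0 * if x i ≠ 0 then 1 else 0) := by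
        gcongr with i
        split_ifs with hi
        · linarith [hh (x i)]
        · rw [not_not.1 hi]
          simp
    _ = loss x + h 0 / n * Finset.card {i | x i ≠ 0} := by
        rw [hloss, Finset.sum_add_distrib, ← Finset.mul_sum, Finset.natCast_card_filter]
        ring
    _ ≤ loss x + h 0 / n * rareHits (fun _ => {-m}ᶜ) B z T := by
        have : 0 ≤ h 0 := hh 0
        gcongr
        convert card_ne_zero_le_rareHits hτ (by positivity) hf hf0 hx

end SparseProblem

section LowerBound

variable {n d S : ℕ} {Cf Cg σ0 σ1 δ μ Lf ε N : ℝ}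

theorem NeedsCalls.mono {p : CFCCO n d} {D : Set (EuclideanSpace ℝ (Fin d))}
    {loss : EuclideanSpace ℝ (Fin d) → ℝ} {N' : ℝ} (h : NeedsCalls.{u} p S D loss ε N)
    (hN : N' ≤ N) : NeedsCalls.{u} p S D loss ε N' :=
  fun τ η ψ hτ hη Ω _ Pr _ s T xbar hx hmem hexp =>
    hN.trans (h τ η ψ hτ hη Ω Pr s T xbar hx hmem hexp)

theorem OuterSmooth.mono {f : ℝ → ℝ} {L L' : ℝ} (h : OuterSmooth f L) (hL : L ≤ L') :
    OuterSmooth f L' :=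
  ⟨h.1, fun u v => (h.2 u v).trans (by gcongr)⟩

/-- Some problem of the class with `Lf`-smooth outer functions requires `N` oracle calls for
an output whose expected squared distance to the minimizer, scaled by `μ / 2`, is at most `ε`. -/
def SmoothLowerBound (n S : ℕ) (Cf Cg σ0 σ1 δ μ Lf ε N : ℝ) : Prop :=
  ∃ (d : ℕ) (p : CFCCO n d) (xs : EuclideanSpace ℝ (Fin d)),
    p.InClass Cf Cg σ0 σ1 δ μ ∧ (∀ i, OuterSmooth (p.f i) Lf) ∧ p.IsMinimizer xs ∧
    NeedsCalls.{u} p S Set.univ (fun x => μ / 2 * ‖x - xs‖ ^ 2) ε N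

/-- Some problem of the class with non-differentiable outer functions requires `N` oracle calls
for a feasible output whose expected optimality gap is at most `ε`. -/
def NonsmoothLowerBound (n S : ℕ) (Cf Cg σ0 σ1 δ μ ε N : ℝ) : Prop :=
  ∃ (d : ℕ) (p : CFCCO n d) (xs : EuclideanSpace ℝ (Fin d)),
    p.InClass Cf Cg σ0 σ1 δ μ ∧ (∀ i, ¬ Differentiable ℝ (p.f i)) ∧ p.IsMinimizer xs ∧
    NeedsCalls.{u} p S p.X (fun x => p.F x - p.F xs) ε N

theorem SmoothLowerBound.mono {N' : ℝ} (h : SmoothLowerBound.{u} n S Cf Cg σ0 σ1 δ μ Lf ε N)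
    (hN : N' ≤ N) : SmoothLowerBound.{u} n S Cf Cg σ0 σ1 δ μ Lf ε N' :=
  let ⟨d, p, xs, hp, hf, hxs, hcalls⟩ := h
  ⟨d, p, xs, hp, hf, hxs, hcalls.mono hN⟩

theorem NonsmoothLowerBound.mono {N' : ℝ} (h : NonsmoothLowerBound.{u} n S Cf Cg σ0 σ1 δ μ ε N)
    (hN : N' ≤ N) : NonsmoothLowerBound.{u} n S Cf Cg σ0 σ1 δ μ ε N' :=
  let ⟨d, p, xs, hp, hf, hxs, hcalls⟩ := h
  ⟨d, p, xs, hp, hf, hxs, hcalls.mono hN⟩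

end LowerBound

section SparseLowerBound

variable {C L u θ : ℝ}

/-- The Huber function: the `L`-smooth function equal to `L / 2 * u ^ 2` near `0` and with slope
`±C` far from `0`. -/
noncomputable def huber (C L : ℝ) : ℝ → ℝ :=
  smoothSupport (Set.Icc (-C) C) L⁻¹

theorem exists_isSmoothSubgradient_huber (hC : 0 ≤ C) (hL : 0 < L) (u : ℝ) :
    ∃ θ, |θ| ≤ C ∧ IsSmoothSubgradient (huber C L) L u θ := by
  obtain ⟨θ, hθ⟩ := exists_isNearestPoint (Set.nonempty_Icc.2 (by linarith))
    (isClosed_Icc (a := -C) (b := C)).isComplete (convex_Icc _ _) (L⁻¹⁻¹ • u)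
  exact ⟨θ, abs_le.2 hθ.1, by simpa [huber] using hθ.isSmoothSubgradient (inv_pos.2 hL)⟩

theorem isSmoothSubgradient_huber (hL : 0 < L) (hu : |L * u| ≤ C) :
    IsSmoothSubgradient (huber C L) L u (L * u) := by
  have hnear : IsNearestPoint (Set.Icc (-C) C) (L⁻¹⁻¹ • u) (L * u) := by
    simpa using isNearestPoint_self (K := Set.Icc (-C) C) (abs_le.1 hu)
  simpa [huber] using hnear.isSmoothSubgradient (inv_pos.2 hL)

theorem huber_nonneg (hC : 0 ≤ C) (hL : 0 < L) (u : ℝ) : 0 ≤ huber C L u :=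
  smoothSupport_nonneg (inv_pos.2 hL) (by simpa using hC) u

theorem huber_zero (hC : 0 ≤ C) (hL : 0 < L) : huber C L 0 = 0 :=
  smoothSupport_zero (inv_pos.2 hL) (by simpa using hC)

theorem isSubgradient_max_zero (h0 : 0 ≤ θ) (h1 : θ ≤ 1) (hu : θ * u = max u 0) :
    IsSubgradient (fun u => max u 0) u θ := fun w => by
  have hw : θ * w ≤ max w 0 := by
    obtain hw | hw := le_total 0 w
    · exact (mul_le_of_le_one_left hw h1).trans (le_max_left _ _)
    · exact (mul_nonpos_of_nonneg_of_nonpos h0 hw).trans (le_max_right _ _)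
  simp only [Real.inner_apply, ← hu]
  linarith

theorem exists_isSubgradient_mul_max_zero (hC : 0 ≤ C) (u : ℝ) :
    ∃ θ, |θ| ≤ C ∧ IsSubgradient (fun u => C * max u 0) u θ := by
  obtain hu | hu := le_total 0 u
  · exact ⟨C • 1, by simp [abs_of_nonneg hC],
      (isSubgradient_max_zero zero_le_one le_rfl (by simp [hu])).const_mul hC⟩
  · exact ⟨C • 0, by simpa using hC,
      (isSubgradient_max_zero le_rfl zero_le_one (by simp [hu])).const_mul hC⟩

theorem not_differentiable_mul_max_zero (hC : 0 < C) :
    ¬ Differentiable ℝ fun u : ℝ => C * max u 0 := fun h => by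
  refine not_differentiableAt_abs_zero ?_
  have abs_eq : abs = fun u : ℝ => 2 * C⁻¹ * (C * max u 0) - u := by
    funext u
    rw [mul_assoc, inv_mul_cancel_left₀ hC.ne']
    obtain hu | hu := le_total 0 u
    · rw [abs_of_nonneg hu, max_eq_left hu]
      ring
    · rw [abs_of_nonpos hu, max_eq_right hu]
      ring
  rw [abs_eq]
  exact ((h 0).const_mul _).sub differentiableAt_id

variable {n S : ℕ} {a Cf Cg σ0 σ1 δ μ Lf ε : ℝ}

theorem smoothLowerBound_huber {L w : ℝ} {q : unitInterval} (hCf : 0 ≤ Cf) (ha : 0 ≤ a)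
    (haCg : a ≤ Cg) (haδ : Cf * a ≤ δ) (hn : 0 < n) (hε : 0 < ε) (hL : 0 < L)
    (hLμ : L ^ 2 = n * μ) (hLf : L ≤ Lf) (hw : |L * w| ≤ Cf) (hεw : 4 * ε ≤ (a * w) ^ 2)
    (hq : 0 < (q : ℝ)) (hqσ : (w + a ^ 2 * (w / L)) ^ 2 ≤ q * σ0 ^ 2) :
    SmoothLowerBound.{u} n S Cf Cg σ0 σ1 δ μ Lf ε (n / (2 * q)) := by
  have : (0 : ℝ) < n := by exact_mod_cast hn
  have hμ : 0 ≤ μ := nonneg_of_mul_nonneg_right (by rw [← hLμ]; positivity) this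
  let v := -(a * (w / L))
  have hv : a * v + (w + a ^ 2 * (w / L)) = w := by ring
  have hsub := exists_isSmoothSubgradient_huber hCf hL
  refine ⟨n, sparseProblem n (huber Cf L) a (w + a ^ 2 * (w / L)) q μ, WithLp.toLp 2 fun _ => v,
    sparseProblem_inClass hq hqσ hCf ha haCg haδ fun u => (hsub u).imp fun _ h => ⟨h.1, h.2.1⟩,
    fun _ => (outerSmooth_of_exists_isSmoothSubgradient fun u =>
      (hsub u).imp fun _ h => h.2).mono hLf,
    sparseProblem_isMinimizer (θ := L * w) hn hq hqσ hμ ?_ ?_,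
    sparseProblem_needsCalls (h := fun u => L ^ 2 / 2 * (u - v) ^ 2) hn hq hμ
      (huber_nonneg hCf hL) (huber_zero hCf hL) hε (fun x => ?_) (fun u => by positivity) ?_⟩
  · rw [hv]
    exact (isSmoothSubgradient_huber hL hw).1
  · rw [← hLμ]
    simp only [v]
    field_simp
    ring
  · simp only [EuclideanSpace.norm_sq_eq, Real.norm_eq_abs, sq_abs, PiLp.sub_apply, hLμ,
      ← Finset.mul_sum]
    field_simp
  · calc 2 * ε ≤ (a * w) ^ 2 / 2 := by linarith
      _ = L ^ 2 / 2 * (0 - v) ^ 2 := by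
        simp only [v]
        field_simp
        ring

theorem smoothLowerBound_sparse (hCf : 0 < Cf) (ha : 0 < a) (haCg : a ≤ Cg) (haδ : Cf * a ≤ δ)
    (hσ0 : 0 < σ0) (hn : 0 < n) (hLf : 0 ≤ Lf) (hε : 0 < ε) (hnμ : 1 ≤ n * μ)
    (hnμLf : n * μ ≤ Lf ^ 2) (hεμ : 4 * (ε * (n * μ)) ≤ (Cf * a) ^ 2)
    (hεσ : 4 * (1 + a ^ 2) ^ 2 * ε ≤ (a * σ0) ^ 2) :
    SmoothLowerBound.{u} n S Cf Cg σ0 σ1 δ μ Lf ε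
      (n / (2 * (4 * (1 + a ^ 2) ^ 2 * ε / (a * σ0) ^ 2))) := by
  obtain ⟨L, hL, hLμ⟩ : ∃ L, 1 ≤ L ∧ L ^ 2 = n * μ :=
    ⟨_, Real.one_le_sqrt.2 hnμ, Real.sq_sqrt (by linarith)⟩
  obtain ⟨w, hw, hεw⟩ : ∃ w, 0 ≤ w ∧ 4 * ε = (a * w) ^ 2 :=
    ⟨2 * √ε / a, by positivity, by
      rw [mul_div_cancel₀ _ ha.ne', mul_pow, Real.sq_sqrt hε.le]
      norm_num⟩
  refine smoothLowerBound_huber (L := L) (w := w)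
    (q := ⟨4 * (1 + a ^ 2) ^ 2 * ε / (a * σ0) ^ 2, by positivity,
      div_le_one_of_le₀ hεσ (by positivity)⟩)
    hCf.le ha.le haCg haδ hn hε (by linarith) hLμ
    (le_of_sq_le_sq (hLμ.trans_le hnμLf) hLf) ?_ hεw.le
    (show 0 < 4 * (1 + a ^ 2) ^ 2 * ε / (a * σ0) ^ 2 by positivity) ?_
  · have : |a * (L * w)| ≤ Cf * a := abs_le_of_sq_le_sq (by
      calc (a * (L * w)) ^ 2 = L ^ 2 * (a * w) ^ 2 := by ring
        _ = 4 * (ε * (n * μ)) := by rw [hLμ, ← hεw]; ring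
        _ ≤ (Cf * a) ^ 2 := hεμ) (by positivity)
    rw [abs_mul, abs_of_pos ha, mul_comm] at this
    exact le_of_mul_le_mul_right this ha
  · calc (w + a ^ 2 * (w / L)) ^ 2 ≤ (w + a ^ 2 * w) ^ 2 := by
          gcongr
          exact div_le_self hw hL
      _ = (1 + a ^ 2) ^ 2 * ((a * w) ^ 2 / a ^ 2) := by field_simp
      _ = 4 * (1 + a ^ 2) ^ 2 * ε / (a * σ0) ^ 2 * σ0 ^ 2 := by
          rw [← hεw]
          field_simp

theorem nonsmoothLowerBound_hinge {m : ℝ} {q : unitInterval} (hCf : 0 < Cf) (ha : 0 < a)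
    (haCg : a ≤ Cg) (haδ : Cf * a ≤ δ) (hn : 0 < n) (hμ : 0 ≤ μ) (hε : 0 < ε) (hm : 0 ≤ m)
    (hεm : 4 * ε ≤ Cf * m) (hmμ : n * μ * m ≤ a ^ 2 * Cf) (hq : 0 < (q : ℝ))
    (hqσ : m ^ 2 ≤ q * σ0 ^ 2) :
    NonsmoothLowerBound.{u} n S Cf Cg σ0 σ1 δ μ ε (n / (2 * q)) := by
  let v := -(m / a)
  have hv : a * v + m = 0 := by simp only [v]; field_simp; ring
  have hmin : a * (Cf • (n * μ * m / (a ^ 2 * Cf))) + n * μ * v = 0 := by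
    simp only [v, smul_eq_mul]
    field_simp
    ring
  have hsub : IsSubgradient (fun u => Cf * max u 0) (a * v + m)
      (Cf • (n * μ * m / (a ^ 2 * Cf))) := by
    rw [hv]
    exact (isSubgradient_max_zero (by positivity) (div_le_one_of_le₀ hmμ (by positivity))
      (by simp)).const_mul hCf.le
  refine ⟨n, sparseProblem n (fun u => Cf * max u 0) a m q μ, WithLp.toLp 2 fun _ => v,
    sparseProblem_inClass hq hqσ hCf.le ha.le haCg haδ (exists_isSubgradient_mul_max_zero hCf.le),
    fun _ => not_differentiable_mul_max_zero hCf,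
    sparseProblem_isMinimizer hn hq hqσ hμ hsub hmin,
    sparseProblem_needsCalls (h := fun u => (Cf * max (a * u + m) 0 + n * μ / 2 * ‖u‖ ^ 2)
      - (Cf * max (a * v + m) 0 + n * μ / 2 * ‖v‖ ^ 2)) hn hq hμ (fun u => by positivity) (by simp)
      hε (fun x => ?_) (fun u => ?_) ?_⟩
  · rw [sparseProblem_F hn hq hqσ, sparseProblem_F hn hq hqσ, ← mul_sub, ← Finset.sum_sub_distrib]
  · exact sub_nonneg.2 (hsub.le_of_mul_add_mul_eq_zero (by positivity) hmin u)
  · have regularizer_le : n * μ / 2 * v ^ 2 ≤ Cf * m / 2 :=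
      calc n * μ / 2 * v ^ 2 = n * μ * m * (m / (2 * a ^ 2)) := by
            simp only [v]
            field_simp
        _ ≤ a ^ 2 * Cf * (m / (2 * a ^ 2)) := by gcongr
        _ = Cf * m / 2 := by field_simp
    rw [hv, mul_zero, zero_add, max_eq_left hm, max_self, norm_zero, Real.norm_eq_abs, sq_abs]
    linarith

theorem nonsmoothLowerBound_sparse (hCf : 0 < Cf) (ha : 0 < a) (haCg : a ≤ Cg)
    (haδ : Cf * a ≤ δ) (hσ0 : 0 < σ0) (hn : 0 < n) (hμ : 0 ≤ μ) (hε : 0 < ε)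
    (hεμ : 4 * (ε * (n * μ)) ≤ (Cf * a) ^ 2) (hεσ : 4 * ε ≤ Cf * σ0) :
    NonsmoothLowerBound.{u} n S Cf Cg σ0 σ1 δ μ ε (n / (2 * (4 * ε / (Cf * σ0)) ^ 2)) := by
  refine nonsmoothLowerBound_hinge (m := 4 * ε / Cf)
    (q := ⟨(4 * ε / (Cf * σ0)) ^ 2, by positivity,
      pow_le_one₀ (by positivity) (div_le_one_of_le₀ hεσ (by positivity))⟩)
    hCf ha haCg haδ hn hμ hε (by positivity) (mul_div_cancel₀ _ hCf.ne').ge ?_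
    (show 0 < (4 * ε / (Cf * σ0)) ^ 2 by positivity) (le_of_eq ?_)
  · rw [← mul_div_assoc, div_le_iff₀ hCf]
    linarith
  · field_simp

end SparseLowerBound

section Simplex

variable {ι : Type*} [Fintype ι] {q v z : EuclideanSpace ℝ ι}

/-- The standard simplex as a subset of Euclidean space. -/
def euclideanSimplex (ι : Type*) [Fintype ι] : Set (EuclideanSpace ℝ ι) :=
  WithLp.ofLp ⁻¹' stdSimplex ℝ ι

theorem exists_isNearestPoint_euclideanSimplex [Nonempty ι] (z : EuclideanSpace ℝ ι) :
    ∃ v, IsNearestPoint (euclideanSimplex ι) z v := by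
  classical
  exact exists_isNearestPoint
    ⟨WithLp.toLp 2 (Pi.single (Classical.arbitrary ι) 1), single_mem_stdSimplex ℝ _⟩
    ((isClosed_stdSimplex ℝ ι).preimage (PiLp.continuous_ofLp 2 _)).isComplete
    ((convex_stdSimplex ℝ ι).linear_preimage (WithLp.linearEquiv 2 ℝ (ι → ℝ)).toLinearMap) z

theorem norm_le_one_of_mem_euclideanSimplex (hq : q ∈ euclideanSimplex ι) : ‖q‖ ≤ 1 := by
  refine (sq_le_one_iff₀ (norm_nonneg q)).1 ?_
  rw [EuclideanSpace.real_norm_sq_eq, ← hq.2]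
  gcongr with j
  exact pow_le_of_le_one (hq.1 j) (mem_Icc_of_mem_stdSimplex hq j).2 two_ne_zero

theorem add_smul_single_sub_single_mem_euclideanSimplex [DecidableEq ι]
    (hv : v ∈ euclideanSimplex ι) (i j : ι) :
    v + v j • (EuclideanSpace.single i 1 - EuclideanSpace.single j 1) ∈ euclideanSimplex ι := by
  refine ⟨fun l => ?_, ?_⟩
  · have hl : 0 ≤ v l := hv.1 l
    have hj : 0 ≤ v j := hv.1 j
    have single_nonneg : 0 ≤ EuclideanSpace.single i (1 : ℝ) l := by
      rw [PiLp.single_apply]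
      positivity
    obtain rfl | hlj := eq_or_ne l j
    · simpa [mul_sub] using mul_nonneg hj single_nonneg
    · simpa [hlj] using add_nonneg hl (mul_nonneg hj single_nonneg)
  · have hsum : ∑ l, v l = 1 := hv.2
    simp [Finset.sum_add_distrib, ← Finset.mul_sum, hsum]

theorem IsNearestPoint.sub_apply_le (h : IsNearestPoint (euclideanSimplex ι) z v) {j : ι}
    (hj : 0 < v j) (i : ι) : z i - v i ≤ z j - v j := by
  classical
  have hvar := h.2 _ (add_smul_single_sub_single_mem_euclideanSimplex h.1 i j)
  rw [add_sub_cancel_left, inner_smul_right, inner_sub_right] at hvar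
  have := nonpos_of_mul_nonpos_right hvar hj
  simp only [EuclideanSpace.inner_single_right, PiLp.sub_apply, conj_trivial, one_mul] at this
  linarith

theorem isNearestPoint_euclideanSimplex_of_sub_apply_eq (hv : v ∈ euclideanSimplex ι) {b : ℝ}
    (hb : ∀ j, z j - v j = b) : IsNearestPoint (euclideanSimplex ι) z v := by
  refine ⟨hv, fun w hw => le_of_eq ?_⟩
  have hvsum : ∑ j, v j = 1 := hv.2
  have hwsum : ∑ j, w j = 1 := hw.2
  simp [PiLp.inner_apply, hb, ← Finset.sum_mul, hvsum, hwsum]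

end Simplex

section ChainProblem

variable {n k t : ℕ} {x v : EuclideanSpace ℝ (Fin k)}

/-- The vector `(0, 1, …, k - 1)`. -/
def indexVec (k : ℕ) : EuclideanSpace ℝ (Fin k) :=
  WithLp.toLp 2 fun j => (j : ℝ)

/-- The vectors supported on the first `t` coordinates. -/
def headSpace (k t : ℕ) : Submodule ℝ (EuclideanSpace ℝ (Fin k)) where
  carrier := {x | ∀ j : Fin k, t ≤ j → x j = 0}
  add_mem' hx hy j hj := by simp [hx j hj, hy j hj]
  zero_mem' j _ := by simp
  smul_mem' c x hx j hj := by simp [hx j hj]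

theorem headSpace_mono (k : ℕ) : Monotone (headSpace k) :=
  fun _ _ h _ hx j hj => hx j (h.trans hj)

theorem IsNearestPoint.mem_headSpace {c : ℝ}
    (h : IsNearestPoint (euclideanSimplex (Fin k)) (c • x - indexVec k) v)
    (hx : x ∈ headSpace k t) : v ∈ headSpace k (t + 1) := by
  intro j hj
  by_contra hne
  have hvj : 0 < v j := (h.1.1 j).lt_of_ne' hne
  let i : Fin k := ⟨t, by lia⟩
  have hvi : v i ≤ 1 := (mem_Icc_of_mem_stdSimplex h.1 i).2
  have hle := h.sub_apply_le hvj i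
  simp only [PiLp.sub_apply, PiLp.smul_apply, hx i le_rfl, hx j (by lia), smul_zero, zero_sub,
    indexVec, i] at hle
  have : (t : ℝ) + 1 ≤ (j : ℕ) := by exact_mod_cast hj
  linarith

theorem sub_mul_sq_le_norm_sub_sq {b : ℝ} (hx : x ∈ headSpace k t) (hb : 0 ≤ b)
    (hv : ∀ j, b ≤ |v j|) : (k - t) * b ^ 2 ≤ ‖x - v‖ ^ 2 := by
  let s : Finset (Fin k) := {j | t ≤ j}
  have card_ge : (k : ℝ) - t ≤ s.card := by
    have card_head : Finset.card {j : Fin k | ¬ t ≤ j} ≤ t := by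
      simp [Fin.card_filter_val_lt]
    have card_add : s.card + Finset.card {j : Fin k | ¬ t ≤ j} = k := by
      simpa using Finset.card_filter_add_card_filter_not (s := Finset.univ) fun j : Fin k => t ≤ j
    rw [sub_le_iff_le_add]
    exact_mod_cast (by lia : k ≤ s.card + t)
  calc (k - t) * b ^ 2 ≤ s.card * b ^ 2 := by gcongr
    _ = ∑ j ∈ s, b ^ 2 := by simp
    _ ≤ ∑ j ∈ s, (x - v) j ^ 2 := by
        refine Finset.sum_le_sum fun j hj => ?_
        rw [PiLp.sub_apply, hx j (Finset.mem_filter.1 hj).2, zero_sub, neg_sq, ← sq_abs (v j)]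
        gcongr
        exact hv j
    _ ≤ ‖x - v‖ ^ 2 := by
        rw [EuclideanSpace.real_norm_sq_eq]
        exact Finset.sum_le_univ_sum_of_nonneg fun j => sq_nonneg _

/-- The minimizer of the chain problem is a negative multiple of this point of the simplex, whose
entries are the uniform ones corrected by a linear term that offsets the shift by `indexVec`. -/
noncomputable def chainWeights (k : ℕ) : EuclideanSpace ℝ (Fin k) :=
  WithLp.toLp 2 fun j => 1 / (k : ℝ) + (((k : ℝ) - 1) / 2 - j) / (1 + (k : ℝ) ^ 2)

theorem one_div_two_mul_le_chainWeights (j : Fin k) : 1 / (2 * (k : ℝ)) ≤ chainWeights k j := by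
  have hk : (1 : ℝ) ≤ k := by exact_mod_cast j.pos
  have hj : (j : ℝ) + 1 ≤ k := by exact_mod_cast j.2
  calc 1 / (2 * (k : ℝ)) = 1 / k - 1 / (2 * k) := by field_simp; norm_num
    _ ≤ 1 / k - (k / 2) / (1 + (k : ℝ) ^ 2) := by
        refine sub_le_sub_left ?_ _
        rw [div_le_div_iff₀ (by positivity) (by positivity)]
        linarith
    _ = 1 / k + (-(k / 2)) / (1 + (k : ℝ) ^ 2) := by ring
    _ ≤ chainWeights k j := by
        change _ ≤ 1 / (k : ℝ) + (((k : ℝ) - 1) / 2 - j) / (1 + (k : ℝ) ^ 2)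
        gcongr
        linarith

theorem chainWeights_mem (hk : 0 < k) : chainWeights k ∈ euclideanSimplex (Fin k) := by
  refine ⟨fun j => le_trans (by positivity) (one_div_two_mul_le_chainWeights j), ?_⟩
  have sum_index : ∑ j : Fin k, (j : ℝ) = k * (k - 1) / 2 := by
    rw [Fin.sum_univ_eq_sum_range (fun j => (j : ℝ)), ← Nat.cast_sum, Finset.sum_range_id,
      ← Nat.choose_two_right, Nat.cast_choose_two]
  simp only [chainWeights, Finset.sum_add_distrib, ← Finset.sum_div, Finset.sum_sub_distrib,
    sum_index, Finset.sum_const, Finset.card_univ, Fintype.card_fin, nsmul_eq_mul]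
  field_simp
  ring

theorem isNearestPoint_chainWeights (hk : 0 < k) :
    IsNearestPoint (euclideanSimplex (Fin k)) (-(k : ℝ) ^ 2 • chainWeights k - indexVec k)
      (chainWeights k) := by
  refine isNearestPoint_euclideanSimplex_of_sub_apply_eq (chainWeights_mem hk)
    (b := -((1 + (k : ℝ) ^ 2) / k + (k - 1) / 2)) fun j => ?_
  simp only [PiLp.sub_apply, PiLp.smul_apply, smul_eq_mul, chainWeights, indexVec]
  field_simp
  ring

variable {Cf Cg σ0 σ1 δ a μ σ ε : ℝ}

theorem isCenteredNoise_dirac_zero : IsCenteredNoise (Measure.dirac 0) σ0 where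
  isProbabilityMeasure := inferInstance
  integrable_id := integrable_dirac (by simp)
  integral_id := integral_dirac _ _
  lintegral_sq_le := by simp

/-- A smoothing of the shifted maximum `x ↦ max_j (x_j - σ * j)`, which is resisting: a gradient
at a vector supported on the first `t` coordinates is supported on the first `t + 1`. -/
noncomputable def chainFn (k : ℕ) (σ : ℝ) (x : EuclideanSpace ℝ (Fin k)) : ℝ :=
  smoothSupport (euclideanSimplex (Fin k)) σ (x - σ • indexVec k)

theorem IsNearestPoint.isSmoothSubgradient_chainFn (hσ : 0 < σ)
    (h : IsNearestPoint (euclideanSimplex (Fin k)) (σ⁻¹ • x - indexVec k) v) :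
    IsSmoothSubgradient (chainFn k σ) σ⁻¹ x v := by
  refine IsSmoothSubgradient.comp_sub_const (IsNearestPoint.isSmoothSubgradient ?_ hσ)
  rwa [smul_sub, inv_smul_smul₀ hσ.ne']

/-- The noiseless problem with linear outer functions whose inner functions all equal
`a * chainFn k σ`. -/
noncomputable def chainProblem (n k : ℕ) (Cf a μ σ : ℝ) : CFCCO n k :=
  ridgeProblem (fun u => Cf * u) (fun _ x => a * chainFn k σ x) (Measure.dirac 0) μ

theorem isSmoothSubgradient_const_mul (u : ℝ) : IsSmoothSubgradient (fun u => Cf * u) 0 u Cf := by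
  have tangent_eq : ∀ w : ℝ, Cf * u + inner ℝ Cf (w - u) = Cf * w := fun w => by
    rw [Real.inner_apply]
    ring
  exact ⟨fun w => (tangent_eq w).le, fun w => by rw [tangent_eq]; simp⟩

theorem chainProblem_inClass (hk : 0 < k) (hσ : 0 < σ) (hCf : 0 ≤ Cf) (ha : 0 ≤ a)
    (haCg : a ≤ Cg) (haδ : Cf * a ≤ δ) :
    (chainProblem n k Cf a μ σ).InClass Cf Cg σ0 σ1 δ μ := by
  have : Nonempty (Fin k) := ⟨⟨0, hk⟩⟩
  refine ridgeProblem_inClass (L := a * σ⁻¹) isCenteredNoise_dirac_zero hCf haCg haδ (fun _ x => ?_)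
    (fun u => ⟨Cf, (abs_of_nonneg hCf).le, (isSmoothSubgradient_const_mul u).1⟩)
    fun _ => .inr fun u v huv => mul_le_mul_of_nonneg_left huv hCf
  obtain ⟨v, hv⟩ := exists_isNearestPoint_euclideanSimplex (σ⁻¹ • x - indexVec k)
  refine ⟨a • v, ?_, (hv.isSmoothSubgradient_chainFn hσ).const_mul ha⟩
  rw [norm_smul, Real.norm_eq_abs, abs_of_nonneg ha]
  exact mul_le_of_le_one_right ha (norm_le_one_of_mem_euclideanSimplex hv.1)

theorem chainProblem_isMinimizer (hn : 0 < n) (hk : 0 < k) (hσ : 0 < σ) (hCf : 0 ≤ Cf)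
    (ha : 0 ≤ a) (hμ : 0 ≤ μ) (hA : Cf * a = μ * (σ * k ^ 2)) :
    (chainProblem n k Cf a μ σ).IsMinimizer (-(σ * k ^ 2) • chainWeights k) := by
  refine ⟨Set.mem_univ _, fun y _ => ?_⟩
  have hnear : IsNearestPoint (euclideanSimplex (Fin k))
      (σ⁻¹ • (-(σ * (k : ℝ) ^ 2) • chainWeights k) - indexVec k) (chainWeights k) := by
    rw [smul_smul, mul_neg, inv_mul_cancel_left₀ hσ.ne']
    exact isNearestPoint_chainWeights hk
  have hsub := ((hnear.isSmoothSubgradient_chainFn hσ).1.const_mul ha).const_mul hCf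
  have objective_eq : ∀ x, (chainProblem n k Cf a μ σ).F x
      = Cf * (a * chainFn k σ x) + μ / 2 * ‖x‖ ^ 2 := fun x => by
    have : (n : ℝ) ≠ 0 := by exact_mod_cast hn.ne'
    rw [chainProblem, ridgeProblem_F (isCenteredNoise_dirac_zero (σ0 := 0))]
    simp only [Finset.sum_const, Finset.card_univ, Fintype.card_fin, nsmul_eq_mul]
    field_simp
  simp only [Set.mem_ofPred_eq, objective_eq]
  refine hsub.add_sq_norm_le hμ ?_ y
  rw [smul_smul, smul_smul, hA, mul_neg, neg_smul, add_neg_cancel]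

theorem chainProblem_primal_le {τ η : ℝ} {ψ : Fin n → DistGen} (hk : 0 < k) (hσ : 0 < σ)
    (ha : 0 ≤ a) (hμη : 0 < μ + η) (B : ℕ → Finset (Fin n)) (z z' : ℕ → Fin n → ℝ) (t : ℕ) :
    (Spaces.iter (chainProblem n k Cf a μ σ) τ η ψ B z z' t).primal ≤ headSpace k t := by
  let p := chainProblem n k Cf a μ σ
  have : Nonempty (Fin k) := ⟨⟨0, hk⟩⟩
  suffices hiter : (Spaces.iter p τ η ψ B z z' t).grad ≤ headSpace k t ∧
      (Spaces.iter p τ η ψ B z z' t).primal ≤ headSpace k t from hiter.2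
  induction t with
  | zero => exact ⟨bot_le, bot_le⟩
  | succ t ih =>
    obtain ⟨grad_le, primal_le⟩ := ih
    have hmono := headSpace_mono k t.le_succ
    set s := Spaces.iter p τ η ψ B z z' t
    have grad_le' : (Spaces.iter p τ η ψ B z z' (t + 1)).grad ≤ headSpace k (t + 1) := by
      refine Spaces.nextGrad_le (grad_le.trans hmono) fun x hx i y _ => ?_
      obtain ⟨v, hv⟩ := exists_isNearestPoint_euclideanSimplex (σ⁻¹ • x - indexVec k)
      have grad_eq : gradient (fun x' => p.g i x' (z' t i)) x = a • v :=
        (((hv.isSmoothSubgradient_chainFn hσ).const_mul ha).hasGradientAt_ridgeProblem_g _).gradient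
      rw [grad_eq]
      exact Submodule.smul_mem _ _ (Submodule.smul_mem _ _ (hv.mem_headSpace (primal_le hx)))
    exact ⟨grad_le', nextPrimal_ridgeProblem_le hμη (primal_le.trans hmono) grad_le'⟩

theorem le_norm_sub_chainWeights_sq (hσ : 0 < σ) (ht : 2 * t ≤ k)
    (hx : x ∈ headSpace k t) :
    σ ^ 2 * k ^ 3 / 8 ≤ ‖x - -(σ * k ^ 2) • chainWeights k‖ ^ 2 := by
  have ht' : 2 * (t : ℝ) ≤ k := by exact_mod_cast ht
  have hentry : ∀ j, σ * k / 2 ≤ |(-(σ * (k : ℝ) ^ 2) • chainWeights k) j| := fun j => by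
    have : (0 : ℝ) < k := by exact_mod_cast j.pos
    have := one_div_two_mul_le_chainWeights j
    calc σ * k / 2 = σ * k ^ 2 * (1 / (2 * k)) := by field_simp
      _ ≤ σ * k ^ 2 * chainWeights k j := by gcongr
      _ ≤ |(-(σ * (k : ℝ) ^ 2) • chainWeights k) j| := by
          rw [PiLp.smul_apply, smul_eq_mul, neg_mul, abs_neg]
          exact le_abs_self _
  calc σ ^ 2 * k ^ 3 / 8 = (k - k / 2) * (σ * k / 2) ^ 2 := by ring
    _ ≤ (k - t) * (σ * k / 2) ^ 2 := by
        gcongr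
        linarith
    _ ≤ _ := sub_mul_sq_le_norm_sub_sq hx (by positivity) hentry

theorem chainProblem_needsCalls {S : ℕ} (hk : 0 < k) (hσ : 0 < σ) (ha : 0 ≤ a) (hμ : 0 < μ)
    (hε : ε < μ / 2 * (σ ^ 2 * k ^ 3 / 8)) :
    NeedsCalls.{u} (chainProblem n k Cf a μ σ) S Set.univ
      (fun x => μ / 2 * ‖x - -(σ * k ^ 2) • chainWeights k‖ ^ 2) ε (S * (k / 2)) := by
  intro τ η ψ _ hη Ω _ Pr _ s T xbar _ hmem hexp
  gcongr
  by_contra! hlt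
  have hT : 2 * T ≤ k := by
    have : 2 * (T : ℝ) ≤ k := by linarith
    exact_mod_cast this
  refine absurd hexp (not_le.2 ?_)
  calc ENNReal.ofReal ε < ENNReal.ofReal (μ / 2 * (σ ^ 2 * k ^ 3 / 8)) :=
        (ENNReal.ofReal_lt_ofReal_iff (by positivity)).2 hε
    _ = ∫⁻ _, ENNReal.ofReal (μ / 2 * (σ ^ 2 * k ^ 3 / 8)) ∂Pr := by simp
    _ ≤ ∫⁻ ω, ENNReal.ofReal (μ / 2 * ‖xbar ω - -(σ * k ^ 2) • chainWeights k‖ ^ 2) ∂Pr := by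
        refine lintegral_mono_ae ?_
        filter_upwards [hmem] with ω hω
        gcongr
        exact le_norm_sub_chainWeights_sq hσ hT
          (chainProblem_primal_le hk hσ ha (by positivity) _ _ _ T hω.1)

theorem smoothLowerBound_chain {S : ℕ} {Lf : ℝ} (hCf : 0 < Cf) (ha : 0 < a) (haCg : a ≤ Cg)
    (haδ : Cf * a ≤ δ) (hn : 0 < n) (hμ : 0 < μ) (hLf : 0 ≤ Lf) (hε : 0 < ε)
    (hεμ : 32 * (ε * μ) ≤ (Cf * a) ^ 2) :
    SmoothLowerBound.{u} n S Cf Cg σ0 σ1 δ μ Lf ε ((Cf * a) ^ 2 / 128 * (S / μ) * ε⁻¹) := by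
  let R := (Cf * a) ^ 2 / (32 * (ε * μ))
  have hR : 1 ≤ R := (one_le_div (by positivity)).2 hεμ
  obtain ⟨k, hk, hkR, hRk⟩ : ∃ k : ℕ, 0 < k ∧ k ≤ R ∧ R ≤ 2 * k := by
    have hfloor := Nat.lt_floor_add_one R
    have hk : 1 ≤ ⌊R⌋₊ := Nat.one_le_floor_iff R |>.2 hR
    have : (1 : ℝ) ≤ ⌊R⌋₊ := by exact_mod_cast hk
    exact ⟨⌊R⌋₊, hk, Nat.floor_le (by linarith), by linarith⟩
  let σ := Cf * a / (μ * k ^ 2)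
  have hσ : 0 < σ := by positivity
  refine ⟨k, chainProblem n k Cf a μ σ, -(σ * k ^ 2) • chainWeights k,
    chainProblem_inClass hk hσ hCf.le ha.le haCg haδ,
    fun _ => (outerSmooth_of_exists_isSmoothSubgradient fun u =>
      ⟨Cf, isSmoothSubgradient_const_mul u⟩).mono hLf,
    chainProblem_isMinimizer hn hk hσ hCf.le ha.le hμ.le (by simp only [σ]; field_simp),
    (chainProblem_needsCalls hk hσ ha.le hμ ?_).mono ?_⟩
  · have hkε : 32 * (ε * μ) * k ≤ (Cf * a) ^ 2 := (le_div_iff₀' (by positivity)).1 hkR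
    calc ε < 2 * ε := by linarith
      _ ≤ (Cf * a) ^ 2 / (16 * μ * k) := by
          rw [le_div_iff₀ (by positivity)]
          linarith
      _ = μ / 2 * (σ ^ 2 * k ^ 3 / 8) := by
          simp only [σ]
          field_simp
          norm_num
  · calc (Cf * a) ^ 2 / 128 * (S / μ) * ε⁻¹ = S * (R / 4) := by
          simp only [R]
          field_simp
          ring
      _ ≤ S * (k / 2) := mul_le_mul_of_nonneg_left (by linarith) (Nat.cast_nonneg S)

end ChainProblem

section Constants

variable {n S : ℕ} {a c Cf Cg σ0 σ1 δ μ Lf ε : ℝ}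

theorem smoothLowerBound_sparse_of_le (hCf : 0 < Cf) (ha : 0 < a) (haCg : a ≤ Cg)
    (haδ : Cf * a ≤ δ) (hσ0 : 0 < σ0) (hn : 0 < n) (hLf : 0 ≤ Lf) (hε : 0 < ε)
    (hnμ : 1 ≤ n * μ) (hnμLf : n * μ ≤ Lf ^ 2) (hcA : c ≤ (Cf * a) ^ 2 / 128)
    (hcσ : c ≤ (a * σ0) ^ 2 / (8 * (1 + a ^ 2) ^ 2)) (hεc : ε * (1 + n * μ) ≤ c) :
    SmoothLowerBound.{u} n S Cf Cg σ0 σ1 δ μ Lf ε (c * n * ε⁻¹) := by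
  have hεnμ : 0 ≤ ε * (n * μ) := by positivity
  rw [mul_add, mul_one] at hεc
  refine (smoothLowerBound_sparse hCf ha haCg haδ hσ0 hn hLf hε hnμ hnμLf ?_ ?_).mono ?_
  · linarith [sq_nonneg (Cf * a)]
  · have hεσ : ε ≤ (a * σ0) ^ 2 / (8 * (1 + a ^ 2) ^ 2) := by linarith
    rw [le_div_iff₀ (by positivity)] at hεσ
    linarith [sq_nonneg (a * σ0)]
  · calc c * n * ε⁻¹ ≤ (a * σ0) ^ 2 / (8 * (1 + a ^ 2) ^ 2) * n * ε⁻¹ := by gcongr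
      _ = n / (2 * (4 * (1 + a ^ 2) ^ 2 * ε / (a * σ0) ^ 2)) := by
        field_simp
        norm_num

theorem smoothLowerBound_chain_of_le (hCf : 0 < Cf) (ha : 0 < a) (haCg : a ≤ Cg)
    (haδ : Cf * a ≤ δ) (hn : 0 < n) (hμ : 0 < μ) (hLf : 0 ≤ Lf) (hε : 0 < ε)
    (hcA : c ≤ (Cf * a) ^ 2 / 128) (hεc : ε * μ ≤ c) :
    SmoothLowerBound.{u} n S Cf Cg σ0 σ1 δ μ Lf ε (c * (S / μ) * ε⁻¹) :=
  (smoothLowerBound_chain hCf ha haCg haδ hn hμ hLf hε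
    (by linarith [sq_nonneg (Cf * a)])).mono (by gcongr)

/- If `S / μ < n`, then `S < n * μ`, so `1 < n * μ` and the restriction on `n * μ` reads
`n * μ ≤ Lf ^ 2`, as the sparse instance requires. -/
theorem smoothLowerBound_max (hCf : 0 < Cf) (ha : 0 < a) (haCg : a ≤ Cg) (haδ : Cf * a ≤ δ)
    (hσ0 : 0 < σ0) (hS : 1 ≤ S) (hn : 0 < n) (hμ : 0 < μ) (hLf : 0 ≤ Lf) (hε : 0 < ε)
    (hnμ : n * μ ≤ max 1 (Lf ^ 2)) (hcA : c ≤ (Cf * a) ^ 2 / 128)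
    (hcσ : c ≤ (a * σ0) ^ 2 / (8 * (1 + a ^ 2) ^ 2)) (hεc : ε * (1 + n * μ) ≤ c) :
    SmoothLowerBound.{u} n S Cf Cg σ0 σ1 δ μ Lf ε (c * max (S / μ) n * ε⁻¹) := by
  obtain hle | hlt := le_or_gt (n : ℝ) (S / μ)
  · rw [max_eq_left hle]
    refine smoothLowerBound_chain_of_le hCf ha haCg haδ hn hμ hLf hε hcA (le_trans ?_ hεc)
    gcongr
    have : μ ≤ n * μ := le_mul_of_one_le_left hμ.le (by exact_mod_cast hn)
    linarith
  · rw [max_eq_right hlt.le]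
    rw [div_lt_iff₀ hμ] at hlt
    have hS' : (1 : ℝ) ≤ S := by exact_mod_cast hS
    have one_lt : 1 < n * μ := by linarith
    exact smoothLowerBound_sparse_of_le hCf ha haCg haδ hσ0 hn hLf hε one_lt.le
      ((le_max_iff.1 hnμ).resolve_left one_lt.not_ge) hcA hcσ hεc

theorem nonsmoothLowerBound_sparse_of_le (hCf : 0 < Cf) (ha : 0 < a) (haCg : a ≤ Cg)
    (haδ : Cf * a ≤ δ) (hσ0 : 0 < σ0) (hn : 0 < n) (hμ : 0 ≤ μ) (hε : 0 < ε)
    (hcA : c ≤ (Cf * a) ^ 2 / 128) (hcσ : c ≤ Cf * σ0 / 4) (hcσ2 : c ≤ (Cf * σ0) ^ 2 / 32)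
    (hεc : ε * (1 + n * μ) ≤ c) :
    NonsmoothLowerBound.{u} n S Cf Cg σ0 σ1 δ μ ε (c * n * (ε ^ 2)⁻¹) := by
  have hεnμ : 0 ≤ ε * (n * μ) := by positivity
  rw [mul_add, mul_one] at hεc
  refine (nonsmoothLowerBound_sparse hCf ha haCg haδ hσ0 hn hμ hε ?_ (by linarith)).mono ?_
  · linarith [sq_nonneg (Cf * a)]
  · calc c * n * (ε ^ 2)⁻¹ ≤ (Cf * σ0) ^ 2 / 32 * n * (ε ^ 2)⁻¹ := by gcongr
      _ = n / (2 * (4 * ε / (Cf * σ0)) ^ 2) := by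
        field_simp
        norm_num

end Constants

theorem theorem4 (Cf Cg σ0 σ1 δ : ℝ) (hCf : 0 < Cf) (hCg : 0 < Cg) (hσ0 : 0 < σ0)
    (hσ1 : 0 ≤ σ1) (hδ : 0 < δ) :
    ∃ c : ℝ, 0 < c ∧
      -- smooth outer functions, strongly convex problems
      (∀ (n S : ℕ) (μ Lf ε : ℝ), 1 ≤ S → S ≤ n → 0 < μ → 0 < Lf → 0 < ε →
        (n : ℝ) * μ ≤ max 1 (Lf ^ 2) → ε * (1 + (n : ℝ) * μ) ≤ c →
        ∃ (d : ℕ) (p : CFCCO n d) (xs : EuclideanSpace ℝ (Fin d)),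
          p.InClass Cf Cg σ0 σ1 δ μ ∧ (∀ i, OuterSmooth (p.f i) Lf) ∧ p.IsMinimizer xs ∧
          NeedsCalls.{u} p S Set.univ (fun x => μ / 2 * ‖x - xs‖ ^ 2) ε
            (c * max ((S : ℝ) / μ) (n : ℝ) * ε⁻¹)) ∧
      -- the first term of the maximum, without the restriction on `n * μ`
      (∀ (n S : ℕ) (μ Lf ε : ℝ), 1 ≤ S → S ≤ n → 0 < μ → 0 < Lf → 0 < ε → ε * μ ≤ c →
        ∃ (d : ℕ) (p : CFCCO n d) (xs : EuclideanSpace ℝ (Fin d)),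
          p.InClass Cf Cg σ0 σ1 δ μ ∧ (∀ i, OuterSmooth (p.f i) Lf) ∧ p.IsMinimizer xs ∧
          NeedsCalls.{u} p S Set.univ (fun x => μ / 2 * ‖x - xs‖ ^ 2) ε
            (c * ((S : ℝ) / μ) * ε⁻¹)) ∧
      -- non-smooth outer functions, merely (`μ = 0`) or strongly (`μ > 0`) convex problems
      (∀ (n S : ℕ) (μ ε : ℝ), 1 ≤ S → S ≤ n → 0 ≤ μ → 0 < ε → ε * (1 + (n : ℝ) * μ) ≤ c →
        ∃ (d : ℕ) (p : CFCCO n d) (xs : EuclideanSpace ℝ (Fin d)),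
          p.InClass Cf Cg σ0 σ1 δ μ ∧ (∀ i, ¬ Differentiable ℝ (p.f i)) ∧ p.IsMinimizer xs ∧
          NeedsCalls.{u} p S p.X (fun x => p.F x - p.F xs) ε
            (c * (n : ℝ) * (ε ^ 2)⁻¹)) := by
  obtain ⟨a, ha, haCg, haδ⟩ : ∃ a, 0 < a ∧ a ≤ Cg ∧ Cf * a ≤ δ :=
    ⟨min Cg (δ / Cf), lt_min hCg (div_pos hδ hCf), min_le_left _ _,
      (le_div_iff₀' hCf).1 (min_le_right _ _)⟩
  obtain ⟨c, hc, hcA, hcSmooth, hcσ, hcσ2⟩ : ∃ c, 0 < c ∧ c ≤ (Cf * a) ^ 2 / 128 ∧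
      c ≤ (a * σ0) ^ 2 / (8 * (1 + a ^ 2) ^ 2) ∧ c ≤ Cf * σ0 / 4 ∧ c ≤ (Cf * σ0) ^ 2 / 32 :=
    ⟨min ((Cf * a) ^ 2 / 128) (min ((a * σ0) ^ 2 / (8 * (1 + a ^ 2) ^ 2))
      (min (Cf * σ0 / 4) ((Cf * σ0) ^ 2 / 32))), by positivity,
      by simp only [min_le_iff, le_refl, true_or, or_true, and_self]⟩
  refine ⟨c, hc, fun n S μ Lf ε hS hSn hμ hLf hε hnμ hεc => ?_,
    fun n S μ Lf ε hS hSn hμ hLf hε hεc => ?_, fun n S μ ε hS hSn hμ hε hεc => ?_⟩ <;>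
    have hn : 0 < n := hS.trans hSn
  · exact smoothLowerBound_max hCf ha haCg haδ hσ0 hS hn hμ hLf.le hε hnμ hcA hcSmooth hεc
  · exact smoothLowerBound_chain_of_le hCf ha haCg haδ hn hμ hLf.le hε hcA hεc
  · exact nonsmoothLowerBound_sparse_of_le hCf ha haCg haδ hσ0 hn hμ hε hcA hcσ hcσ2 hεc
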